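/- Let $k$ be a commutative ring (associative, with unit); $\otimes=\otimes_k$. For $n\in\mathbb Z$, $j\in\mathbb Z_{\ge0}$ put $\binom nj=\frac{n(n-1)\cdots(n-j+1)}{j!}$. A ($\mathbb Z_{\ge 0}$-graded) conformal algebra is a $k$-module $C=\bigoplus_{i\ge0}C_i$ with $k$-linear maps $\partial^{(j)}:C\to C$ of degree $j$ and $k$-bilinear operations $(a,b)\mapsto a_{(n)}b$ of degree $-n-1$ ($j,n\in\mathbb Z_{\ge0}$; $C_i=0$ for $i<0$), such that for all $a,b,c\in C$ and $m,n,i,j\ge0$ $$\partial^{(0)}=\mathrm{Id},\qquad \partial^{(i)}\partial^{(j)}=\tbinom{i+j}{i}\partial^{(i+j)},\qquad (\partial^{(i)}a)_{(n)}b=(-1)^i\tbinom ni a_{(n-i)}b,$$ $$a_{(n)}b=(-1)^{n+1}\sum_{j\ge0}(-1)^j\partial^{(j)}(b_{(n+j)}a),\qquad a_{(m)}(b_{(n)}c)=b_{(n)}(a_{(m)}c)+\sum_{j=0}^m\tbinom mj(a_{(j)}b)_{(m+n-j)}c .$$ A ($\mathbb Z_{\ge 0}$-graded) vertex algebra is a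 $k$-module $V=\bigoplus_{i\ge0}V_i$ with a vacuum vector $\mathbf 1\in V_0$ and $k$-bilinear operations $(a,b)\mapsto a_{(n)}b$ of degree $-n-1$ ($n\in\mathbb Z$; $V_i=0$ for $i<0$), such that $\mathbf 1_{(n)}a=\delta_{n,-1}a$, $a_{(-1)}\mathbf 1=a$, $a_{(n)}\mathbf 1=0$ for $n\ge0$, and for all $a,b,c\in V$, $m,n,l\in\mathbb Z$ $$\sum_{j\ge0}\tbinom mj(a_{(n+j)}b)_{(m+l-j)}c=\sum_{j\ge0}(-1)^j\tbinom nj\bigl\{a_{(m+n-j)}(b_{(l+j)}c)-(-1)^n b_{(n+l-j)}(a_{(m+j)}c)\bigr\}.$$ Morphisms are the degree-preserving $k$-linear maps respecting all operations (and the vacuum vector, for vertex algebras); this gives categories $\mathcal{C}onf$ and $\mathcal{V}ert$. The forgetful functor $\mathcal{V}ert\to\mathcal{C}onf$ sends $V$ to the same graded module with the operations $_{(n)}$, $n\ge 0$, and $\partial^{(j)}a=a_{(-1-j)}\mathbf 1$. For a conformal algebra $C$ let $TC$ be the tensor algebra of the $k$-module $C$, graded by the grading of $C$, let $R\subset TC$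 be the two-sided ideal generated by the elements $$xy-yx-\sum_{j\ge0}(-1)^j\partial^{(j+1)}(x_{(j)}y),\qquad x,y\in C,$$ let $p:TC\to UC:=TC/R$ be the projection and $i:C\to UC$ the restriction of $p$ to $C=T^1C$. **Theorem 8.3.** (a) For every conformal algebra $C$ there is a unique structure of a $\mathbb Z_{\ge0}$-graded vertex algebra on the $k$-module $UC$ with vacuum vector $p(1)$ such that $i$ is a morphism of conformal algebras and $$p(xz)=i(x)_{(-1)}p(z)\qquad\text{for all }x\in C,\ z\in TC .$$ Its grading is the one induced by the grading of $TC$. (b) With these structures, $C\mapsto UC$ is the object map of a functor $U:\mathcal{C}onf\to\mathcal{V}ert$ left adjoint to the forgetful functor, and the unit of the adjunction is $i$. -/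

import Mathlib

open CategoryTheory

universe u v w

section GradedModules

variable {k : Type u} [CommRing k] {M : Type v} [AddCommGroup M] [Module k M]

/-- The component in an integral degree of a family of submodules indexed by `ℕ`:
the component of negative degree is zero. -/
def degreePart (gr : ℕ → Submodule k M) : ℤ → Submodule k M
  | Int.ofNat i => gr i
  | Int.negSucc _ => ⊥

end GradedModules

/-- A structure of a `ℤ≥0`-graded conformal algebra on a `k`-module `C`.
`D j` is the operator `∂^(j)` and `mul n a b` is the product `a_(n) b`. All sums over `j : ℕ` are
finite for degree reasons. -/
@[ext]
structure ConformalStructure (k : Type u) [CommRing k] (C : Type v) [AddCommGroup C]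
    [Module k C] where
  /-- the grading `C = ⨁ C_i` -/
  gr : ℕ → Submodule k C
  internal : DirectSum.IsInternal gr
  /-- the operators `∂^(j)` -/
  D : ℕ → C →ₗ[k] C
  /-- the products `a_(n) b`, `n ≥ 0` -/
  mul : ℕ → C →ₗ[k] C →ₗ[k] C
  D_mem : ∀ (j i : ℕ) (a : C), a ∈ gr i → D j a ∈ gr (i + j)
  mul_mem : ∀ (n i j : ℕ) (a b : C), a ∈ gr i → b ∈ gr j →
    mul n a b ∈ degreePart gr ((i : ℤ) + (j : ℤ) - (n : ℤ) - 1)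
  D_zero : ∀ a : C, D 0 a = a
  D_comp : ∀ (i j : ℕ) (a : C), D i (D j a) = (i + j).choose i • D (i + j) a
  /-- `(∂^(i) a)_(n) b = (-1)^i (n choose i) a_(n-i) b`; the right side is `0` for `i > n`, since
  then the binomial coefficient vanishes. -/
  mul_D : ∀ (i n : ℕ) (a b : C),
    mul n (D i a) b = ((-1 : ℤ) ^ i * (n.choose i : ℤ)) • mul (n - i) a b
  mul_comm : ∀ (n : ℕ) (a b : C),
    mul n a b = (-1 : ℤ) ^ (n + 1) • ∑ᶠ j : ℕ, (-1 : ℤ) ^ j • D j (mul (n + j) b a)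
  mul_mul : ∀ (m n : ℕ) (a b c : C),
    mul m a (mul n b c) = mul n b (mul m a c) +
      ∑ j ∈ Finset.range (m + 1), m.choose j • mul (m + n - j) (mul j a b) c

/-- A structure of a `ℤ≥0`-graded vertex algebra on a `k`-module `V`.
`mul n a b` is the product `a_(n) b`. All sums over `j : ℕ` are finite for degree reasons, and
`Ring.choose m j` is the binomial coefficient `m (m-1) ⋯ (m-j+1) / j!` of an integer `m`. -/
@[ext]
structure VertexStructure (k : Type u) [CommRing k] (V : Type v) [AddCommGroup V]
    [Module k V] where
  /-- the grading `V = ⨁ V_i` -/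
  gr : ℕ → Submodule k V
  internal : DirectSum.IsInternal gr
  /-- the vacuum vector -/
  vac : V
  vac_mem : vac ∈ gr 0
  /-- the products `a_(n) b`, `n ∈ ℤ` -/
  mul : ℤ → V →ₗ[k] V →ₗ[k] V
  mul_mem : ∀ (n : ℤ) (i j : ℕ) (a b : V), a ∈ gr i → b ∈ gr j →
    mul n a b ∈ degreePart gr ((i : ℤ) + (j : ℤ) - n - 1)
  vac_mul : ∀ (n : ℤ) (a : V), mul n vac a = if n = -1 then a else 0
  mul_vac : ∀ a : V, mul (-1) a vac = a
  mul_vac_of_nonneg : ∀ (n : ℤ) (a : V), 0 ≤ n → mul n a vac = 0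
  borcherds : ∀ (m n l : ℤ) (a b c : V),
    ∑ᶠ j : ℕ, Ring.choose m j • mul (m + l - j) (mul (n + j) a b) c =
      ∑ᶠ j : ℕ, ((-1 : ℤ) ^ j * Ring.choose n j) •
        (mul (m + n - j) a (mul (l + j) b c) -
          (n.negOnePow : ℤ) • mul (n + l - j) b (mul (m + j) a c))

namespace VertexStructure

variable {k : Type u} [CommRing k] {V : Type v} [AddCommGroup V] [Module k V]
  (S : VertexStructure k V)

/-- The operators `∂^(j) a = a_(-1-j) 1`. -/
def D (j : ℕ) : V →ₗ[k] V := (S.mul (-1 - j)).flip S.vac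

lemma D_apply (j : ℕ) (a : V) : S.D j a = S.mul (-1 - j) a S.vac := rfl

lemma D_mem (j i : ℕ) (a : V) (ha : a ∈ S.gr i) : S.D j a ∈ S.gr (i + j) := by
  have h := S.mul_mem (-1 - j) i 0 a S.vac ha S.vac_mem
  have e : ((i : ℤ) + ((0 : ℕ) : ℤ) - (-1 - (j : ℤ)) - 1) = Int.ofNat (i + j) := by
    simp only [Int.ofNat_eq_natCast]; push_cast; ring
  rw [e] at h
  exact h

lemma D_zero (a : V) : S.D 0 a = a := by
  simpa [D_apply] using S.mul_vac a

lemma choose_neg_one_sub (a b : ℕ) :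
    Ring.choose (-1 - (a : ℤ)) b = (-1 : ℤ) ^ b * ((a + b).choose b : ℤ) := by
  have h1 : (-1 - (a : ℤ)) = -((a : ℤ) + 1) := by ring
  rw [h1, Ring.choose_neg]
  have h2 : ((a : ℤ) + 1 + b - 1) = ((a + b : ℕ) : ℤ) := by push_cast; ring
  rw [h2, Ring.choose_natCast, Units.smul_def, smul_eq_mul, Int.coe_negOnePow_natCast]

lemma borcherds_zero (n l : ℤ) (a b c : V) :
    S.mul l (S.mul n a b) c =
      ∑ᶠ j : ℕ, ((-1 : ℤ) ^ j * Ring.choose n j) •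
        (S.mul (n - j) a (S.mul (l + j) b c) -
          (n.negOnePow : ℤ) • S.mul (n + l - j) b (S.mul j a c)) := by
  have h := S.borcherds 0 n l a b c
  rw [finsum_eq_single _ 0 (fun j hj => by
    rw [Ring.choose_zero_pos ℤ (by omega), zero_smul])] at h
  simpa using h

lemma D_comp (i j : ℕ) (a : V) :
    S.D i (S.D j a) = (i + j).choose i • S.D (i + j) a := by
  rw [D_apply, D_apply, borcherds_zero, finsum_eq_single _ i]
  · rw [S.vac_mul, if_pos (by ring), S.mul_vac_of_nonneg (i : ℤ) a (by positivity), map_zero,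
      smul_zero, sub_zero, choose_neg_one_sub, ← mul_assoc, ← mul_pow]
    simp only [D_apply]
    rw [show (-1 - (j : ℤ) - i) = -1 - ((i + j : ℕ) : ℤ) by push_cast; ring, add_comm j i]
    simp
  · intro t ht
    rw [S.vac_mul, if_neg (by omega), S.mul_vac_of_nonneg (t : ℤ) a (by positivity)]
    simp

lemma mul_D (i n : ℕ) (a b : V) :
    S.mul n (S.D i a) b =
      ((-1 : ℤ) ^ i * (n.choose i : ℤ)) • S.mul ((n - i : ℕ) : ℤ) a b := by
  rw [D_apply, borcherds_zero]
  have h0 : ∀ j : ℕ, S.mul ((n : ℤ) + j) S.vac b = 0 := fun j => by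
    rw [S.vac_mul, if_neg (by omega)]
  simp only [h0, map_zero, zero_sub]
  by_cases hin : i ≤ n
  · rw [finsum_eq_single _ (n - i)]
    · rw [S.vac_mul, if_pos (by omega), choose_neg_one_sub, ← mul_assoc, ← mul_pow, smul_neg,
        smul_smul, ← neg_smul]
      congr 1
      have e : (-1 - (i : ℤ)) = -((i + 1 : ℕ) : ℤ) := by push_cast; ring
      rw [e, Int.negOnePow_neg, Int.coe_negOnePow_natCast, Nat.add_sub_cancel' hin,
        Nat.choose_symm hin]
      simp [pow_succ, mul_comm]
    · intro t ht
      rw [S.vac_mul, if_neg (by omega)]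
      simp
  · rw [Nat.choose_eq_zero_of_lt (by omega)]
    simp only [Nat.cast_zero, mul_zero, zero_smul]
    apply finsum_eq_zero_of_forall_eq_zero
    intro t
    rw [S.vac_mul, if_neg (by omega)]
    simp

lemma mul_comm (n : ℕ) (a b : V) :
    S.mul n a b =
      (-1 : ℤ) ^ (n + 1) • ∑ᶠ j : ℕ, (-1 : ℤ) ^ j • S.D j (S.mul ((n + j : ℕ) : ℤ) b a) := by
  have h := S.borcherds (-1) n 0 b a S.vac
  have hc : ∀ j : ℕ, Ring.choose (-1 : ℤ) j = (-1) ^ j := fun j => by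
    simpa using choose_neg_one_sub 0 j
  rw [finsum_eq_single (fun j : ℕ => ((-1 : ℤ) ^ j * Ring.choose (n : ℤ) j) • _) 0] at h
  · simp only [hc, Nat.cast_zero, Ring.choose_zero_right, pow_zero, mul_one, one_smul, add_zero,
      sub_zero, S.mul_vac, S.mul_vac_of_nonneg _ _ le_rfl, map_zero, zero_sub,
      Int.coe_negOnePow_natCast] at h
    have e : ∀ j : ℕ, S.D j (S.mul ((n + j : ℕ) : ℤ) b a) =
        S.mul (-1 - (j : ℤ)) (S.mul ((n : ℤ) + j) b a) S.vac := fun j => by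
      rw [D_apply]; push_cast; rfl
    simp only [e]
    rw [h, smul_neg, smul_smul, ← neg_smul, pow_succ]
    have : -((-1 : ℤ) ^ n * -1 * (-1) ^ n) = 1 := by
      rw [show -((-1 : ℤ) ^ n * -1 * (-1) ^ n) = ((-1) * (-1)) ^ n by rw [mul_pow]; ring]
      simp
    rw [this, one_smul]
  · intro j hj
    rw [S.mul_vac_of_nonneg _ a (by positivity), S.mul_vac_of_nonneg _ b (by omega)]
    simp

lemma mul_mul (m n : ℕ) (a b c : V) :
    S.mul m a (S.mul n b c) = S.mul n b (S.mul m a c) +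
      ∑ j ∈ Finset.range (m + 1), m.choose j • S.mul ((m + n - j : ℕ) : ℤ) (S.mul j a b) c := by
  have h := S.borcherds m 0 n a b c
  rw [finsum_eq_single (fun j : ℕ => ((-1 : ℤ) ^ j * Ring.choose (0 : ℤ) j) • _) 0
    (fun j hj => by rw [Ring.choose_zero_pos ℤ (by omega), mul_zero, zero_smul]),
    finsum_eq_sum_of_support_subset (s := Finset.range (m + 1))] at h
  · simp only [Nat.cast_zero, Ring.choose_zero_right, pow_zero, mul_one, one_smul, add_zero,
      sub_zero, zero_add, Int.negOnePow_zero, Units.val_one, Ring.choose_natCast] at h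
    rw [eq_comm, sub_eq_iff_eq_add'] at h
    rw [h]
    congr 1
    refine Finset.sum_congr rfl fun j hj => ?_
    rw [Finset.mem_range] at hj
    rw [natCast_zsmul, Nat.cast_sub (by omega), Nat.cast_add]
  · intro j hj
    by_contra hlt
    rw [Finset.mem_coe, Finset.mem_range, not_lt] at hlt
    apply hj
    simp only [Ring.choose_natCast]
    rw [Nat.choose_eq_zero_of_lt (by omega)]
    simp

/-- The conformal algebra obtained from a vertex algebra by forgetting the products `a_(n) b`
with `n < 0`; here `∂^(j) a = a_(-1-j) 1`. -/
def toConformal : ConformalStructure k V where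
  gr := S.gr
  internal := S.internal
  D := S.D
  mul n := S.mul n
  D_mem := S.D_mem
  mul_mem n i j a b ha hb := S.mul_mem n i j a b ha hb
  D_zero := S.D_zero
  D_comp := S.D_comp
  mul_D := S.mul_D
  mul_comm := S.mul_comm
  mul_mul := S.mul_mul

end VertexStructure

/-- A linear map is a morphism of conformal algebras if it preserves degrees, the operators
`∂^(j)` and all products. -/
structure IsConformalHom {k : Type u} [CommRing k] {C : Type v} [AddCommGroup C] [Module k C]
    {C' : Type w} [AddCommGroup C'] [Module k C'] (S : ConformalStructure k C)
    (S' : ConformalStructure k C') (f : C →ₗ[k] C') : Prop where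
  map_gr : ∀ (i : ℕ) (a : C), a ∈ S.gr i → f a ∈ S'.gr i
  map_D : ∀ (j : ℕ) (a : C), f (S.D j a) = S'.D j (f a)
  map_mul : ∀ (n : ℕ) (a b : C), f (S.mul n a b) = S'.mul n (f a) (f b)

/-- A linear map is a morphism of vertex algebras if it preserves degrees, the vacuum vector
and all products. -/
structure IsVertexHom {k : Type u} [CommRing k] {V : Type v} [AddCommGroup V] [Module k V]
    {V' : Type w} [AddCommGroup V'] [Module k V'] (S : VertexStructure k V)
    (S' : VertexStructure k V') (f : V →ₗ[k] V') : Prop where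
  map_gr : ∀ (i : ℕ) (a : V), a ∈ S.gr i → f a ∈ S'.gr i
  map_vac : f S.vac = S'.vac
  map_mul : ∀ (n : ℤ) (a b : V), f (S.mul n a b) = S'.mul n (f a) (f b)

/-- `ℤ≥0`-graded conformal algebras over `k`. -/
structure ConformalAlg (k : Type u) [CommRing k] where
  carrier : Type v
  [addCommGroup : AddCommGroup carrier]
  [module : Module k carrier]
  str : ConformalStructure k carrier

attribute [instance] ConformalAlg.addCommGroup ConformalAlg.module

/-- `ℤ≥0`-graded vertex algebras over `k`. -/
structure VertexAlg (k : Type u) [CommRing k] where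
  carrier : Type v
  [addCommGroup : AddCommGroup carrier]
  [module : Module k carrier]
  str : VertexStructure k carrier

attribute [instance] VertexAlg.addCommGroup VertexAlg.module

/-- Morphisms of conformal algebras. -/
@[ext]
structure ConformalAlg.Hom {k : Type u} [CommRing k] (C C' : ConformalAlg.{u, v} k) where
  lin : C.carrier →ₗ[k] C'.carrier
  isHom : IsConformalHom C.str C'.str lin

/-- Morphisms of vertex algebras. -/
@[ext]
structure VertexAlg.Hom {k : Type u} [CommRing k] (V V' : VertexAlg.{u, v} k) where
  lin : V.carrier →ₗ[k] V'.carrier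
  isHom : IsVertexHom V.str V'.str lin

/-- The category of `ℤ≥0`-graded conformal algebras over `k`. -/
instance ConformalAlg.category {k : Type u} [CommRing k] : Category (ConformalAlg.{u, v} k) where
  Hom := ConformalAlg.Hom
  id C := ⟨LinearMap.id, ⟨fun _ _ h => h, fun _ _ => rfl, fun _ _ _ => rfl⟩⟩
  comp f g := ⟨g.lin.comp f.lin,
    ⟨fun i a h => g.isHom.map_gr i _ (f.isHom.map_gr i a h),
     fun j a => by
      simp only [LinearMap.comp_apply, f.isHom.map_D, g.isHom.map_D],
     fun n a b => by
      simp only [LinearMap.comp_apply, f.isHom.map_mul, g.isHom.map_mul]⟩⟩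

/-- The category of `ℤ≥0`-graded vertex algebras over `k`. -/
instance VertexAlg.category {k : Type u} [CommRing k] : Category (VertexAlg.{u, v} k) where
  Hom := VertexAlg.Hom
  id V := ⟨LinearMap.id, ⟨fun _ _ h => h, rfl, fun _ _ _ => rfl⟩⟩
  comp f g := ⟨g.lin.comp f.lin,
    ⟨fun i a h => g.isHom.map_gr i _ (f.isHom.map_gr i a h),
     by simp only [LinearMap.comp_apply, f.isHom.map_vac, g.isHom.map_vac],
     fun n a b => by
      simp only [LinearMap.comp_apply, f.isHom.map_mul, g.isHom.map_mul]⟩⟩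

/-- The forgetful functor from vertex algebras to conformal algebras. -/
def VertexAlg.forgetToConformal (k : Type u) [CommRing k] :
    VertexAlg.{u, v} k ⥤ ConformalAlg.{u, v} k where
  obj V := { carrier := V.carrier, str := V.str.toConformal }
  map f := ⟨f.lin, ⟨f.isHom.map_gr,
    fun j a => by
      refine (f.isHom.map_mul (-1 - j) a _).trans ?_
      rw [f.isHom.map_vac]
      rfl,
    fun n a b => f.isHom.map_mul n a b⟩⟩

namespace ConformalStructure

variable {k : Type u} [CommRing k] {C : Type v} [AddCommGroup C] [Module k C]
  (S : ConformalStructure k C)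

/-- The elements `r(x,y) = xy - yx - ∑_{j ≥ 0} (-1)^j ∂^(j+1) (x_(j) y)` of the tensor algebra. -/
noncomputable def relator (x y : C) : TensorAlgebra k C :=
  TensorAlgebra.ι k x * TensorAlgebra.ι k y - TensorAlgebra.ι k y * TensorAlgebra.ι k x -
    TensorAlgebra.ι k (∑ᶠ j : ℕ, (-1 : ℤ) ^ j • S.D (j + 1) (S.mul j x y))

/-- The two-sided ideal `R` generated by all elements `r(x,y)`. -/
def relIdeal : TwoSidedIdeal (TensorAlgebra k C) :=
  TwoSidedIdeal.span {t | ∃ x y : C, t = S.relator x y}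

/-- The quotient `UC = TC / R`. -/
abbrev Envelope : Type (max u v) := S.relIdeal.ringCon.Quotient

/-- The projection `p : TC → UC`. -/
def proj : TensorAlgebra k C →ₐ[k] S.Envelope := S.relIdeal.ringCon.mkₐ k

/-- The canonical map `i : C → UC`, the restriction of `p` to `C ⊂ TC`. -/
noncomputable def incl : C →ₗ[k] S.Envelope := S.proj.toLinearMap ∘ₗ TensorAlgebra.ι k

/-- The grading of the tensor algebra induced by the grading of `C`: the component of degree `n`
is spanned by the products `x₁ ⋯ x_r` of homogeneous elements whose degrees add up to `n`. -/
def tensorGr (n : ℕ) : Submodule k (TensorAlgebra k C) :=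
  Submodule.span k {t | ∃ l : List (ℕ × C), (∀ q ∈ l, q.2 ∈ S.gr q.1) ∧
    (l.map (fun q => q.1)).sum = n ∧ t = (l.map (fun q => TensorAlgebra.ι k q.2)).prod}

/-- The grading of `UC` inherited from the tensor algebra. -/
def envelopeGr (n : ℕ) : Submodule k S.Envelope := (S.tensorGr n).map S.proj.toLinearMap

/-- The vertex algebra structures on `UC` that are compatible with its construction: the vacuum
vector is the unit `p(1)`, the canonical map `i : C → UC` is a morphism of conformal algebras, and
`p(xz) = i(x)_(-1) p(z)` for `x ∈ C`, `z ∈ TC`. -/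
structure IsEnvelopeStructure (W : VertexStructure k S.Envelope) : Prop where
  vac_eq : W.vac = S.proj 1
  incl_isHom : IsConformalHom S W.toConformal S.incl
  proj_ι_mul : ∀ (x : C) (z : TensorAlgebra k C),
    S.proj (TensorAlgebra.ι k x * z) = W.mul (-1) (S.incl x) (S.proj z)

end ConformalStructure

/-!
# The enveloping vertex algebra of a conformal algebra

The relations of `UC` say that `xy - yx = [x, y]` for the bracket `[x, y] = ∑_j (-1)^j ∂^(j+1)
(x_(j) y)`, so that `UC` is the universal enveloping algebra of `C` with this bracket. A vertex
algebra structure of the required kind has modes `x_n`, for `x` in `C` and `n : ℤ`, with `x_{-1}`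
the left multiplication by `x`, with `x_n 1` equal to `∂^(j) x` if `n = -1 - j` and to `0` if `n ≥
0`, and with the commutators `[x_n, y_m] = ∑_j (n choose j) (x_(j) y)_{n+m-j}`, which are called
`bracket` below. These conditions determine `x_n` recursively. Since `UC` need not have a basis of
ordered monomials over a general ring, the recursion is turned into an action of `UC`: `mulFamily`
prescribes how the family of all `x_n z` changes when `z` is multiplied by `y`, and
`modeAction_mul_sub` shows, by the Jacobi identity `bracket_jacobi`, that this prescription
respects the relations of `UC`. This gives the modes on `UC`, and an induction gives the
commutator formula for all pairs of modes (`mode_comm`). Likewise `∂^(r)` extends to `UC`, with a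
Leibniz rule for modes (`trans_mode`).

The fields `∑_n x_n z^{-n-1}` are pairwise local, because `x_(j) y = 0` for large `j`; they are
covariant under translation and they generate `UC` from `1`. The rest of the structure comes from
the reconstruction theorem for vertex algebras (`VField.IsGenerating`), which is proved here over
an arbitrary ring: products of pairwise local fields are local (Dong's lemma,
`VField.IsLocal.nprod`), a translation covariant local field is determined by its state
(`VField.IsGenerating.op_eq`), and local fields satisfy the Borcherds identity
(`VField.borcherds_of_isLocal`). All these are statements about multiplication of two-variable
distributions by powers `(z - w)^n`, which is the function `expand`. The sum of the graded
components of `UC` is direct since `UC` has a homomorphism to `UC[t]` that sends `z` of degree `n`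
to `z t^n`.

Let `f : C → V` be a morphism to a vertex algebra. Its operators `f(x)_(-1)` satisfy the relations
of `UC`, hence `UC` acts on `V`, and `z ↦ z · 1` is a linear map `UC → V` (`extend`) that
intertwines the left multiplications by `x` with `f(x)_(-1)`. The commutator formula in `V` shows
that it intertwines all modes, and then that it respects all products. This is the only morphism
that extends `f`, which proves the adjunction. For `V = UC` with another structure of the required
kind and `f = i` this map is the identity, which proves that the structure is unique.
-/

open Finset.HasAntidiagonal (antidiagonal mem_antidiagonal)

/-! ### Sums over `ℕ` and over antidiagonals -/

theorem finsum_eq_sum_range {E : Type*} [AddCommMonoid E] {f : ℕ → E} {N : ℕ}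
    (h : ∀ j, N ≤ j → f j = 0) : ∑ᶠ j, f j = ∑ j ∈ Finset.range N, f j := by
  apply finsum_eq_sum_of_support_subset
  intro j hj
  by_contra hlt
  simp only [Finset.coe_range, Set.mem_Iio, not_lt] at hlt
  exact hj (h j hlt)

theorem sum_range_range_eq_sum_antidiagonal {E : Type*} [AddCommMonoid E] {f : ℕ → ℕ → E}
    {N : ℕ} (h : ∀ i j, N ≤ i + j → f i j = 0) :
    ∑ i ∈ Finset.range N, ∑ j ∈ Finset.range N, f i j =
      ∑ d ∈ Finset.range N, ∑ p ∈ antidiagonal d, f p.1 p.2 := by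
  simp only [Finset.Nat.sum_antidiagonal_eq_sum_range_succ_mk, Nat.succ_eq_add_one]
  rw [Finset.sum_range_diag_flip]
  refine Finset.sum_congr rfl fun i hi => (Finset.sum_subset ?_ ?_).symm
  · intro j hj
    simp only [Finset.mem_range] at *
    omega
  · intro j hj hj'
    simp only [Finset.mem_range] at *
    exact h i j (by omega)

theorem sum_antidiagonal_assoc {E : Type*} [AddCommMonoid E] (f : ℕ → ℕ → ℕ → E) (d : ℕ) :
    ∑ p ∈ antidiagonal d, ∑ q ∈ antidiagonal p.1, f q.1 q.2 p.2 =
      ∑ p ∈ antidiagonal d, ∑ q ∈ antidiagonal p.2, f p.1 q.1 q.2 := by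
  simp only [Finset.sum_sigma']
  apply Finset.sum_nbij' (fun ⟨⟨_i, j⟩, ⟨k, l⟩⟩ ↦ ⟨(k, l + j), (l, j)⟩)
    (fun ⟨⟨i, _j⟩, ⟨k, l⟩⟩ ↦ ⟨(i + k, l), (i, k)⟩)
  · rintro ⟨⟨i, j⟩, ⟨k, l⟩⟩ h
    simp only [Finset.mem_sigma, mem_antidiagonal, and_true] at h ⊢
    omega
  · rintro ⟨⟨i, j⟩, ⟨k, l⟩⟩ h
    simp only [Finset.mem_sigma, mem_antidiagonal, and_true] at h ⊢
    omega
  · rintro ⟨⟨i, j⟩, ⟨k, l⟩⟩ h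
    simp only [Finset.mem_sigma, mem_antidiagonal] at h
    obtain ⟨-, rfl⟩ := h
    rfl
  · rintro ⟨⟨i, j⟩, ⟨k, l⟩⟩ h
    simp only [Finset.mem_sigma, mem_antidiagonal] at h
    obtain ⟨-, rfl⟩ := h
    rfl
  · intros
    rfl

/-! ### Binomial coefficients with integral upper entry -/

theorem choose_vandermonde (m n : ℤ) (d : ℕ) :
    ∑ p ∈ antidiagonal d, Ring.choose m p.1 * Ring.choose n p.2 = Ring.choose (m + n) d :=
  (Ring.add_choose_eq d (Commute.all m n)).symm

theorem choose_add_mul_choose (m : ℤ) (s t : ℕ) :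
    Ring.choose m (s + t) * ((s + t).choose s : ℤ) = Ring.choose m s * Ring.choose (m - s) t := by
  have h := Ring.choose_add_smul_choose (m - s) t s
  rw [sub_add_cancel, add_comm t s, nsmul_eq_mul, mul_comm] at h
  exact h

theorem choose_mul_choose_sub_comm (m : ℤ) (s t : ℕ) :
    Ring.choose m s * Ring.choose (m - s) t = Ring.choose m t * Ring.choose (m - t) s := by
  rw [← choose_add_mul_choose, ← choose_add_mul_choose, add_comm t s, Nat.choose_symm_add]

theorem choose_sub_one_eq (n : ℤ) (d : ℕ) :
    Ring.choose (d - n - 1) d = (-1 : ℤ) ^ d * Ring.choose n d := by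
  have h := Ring.choose_neg (-n) d
  rw [neg_neg] at h
  rw [h, Units.smul_def, smul_eq_mul, Int.coe_negOnePow_natCast, ← mul_assoc, ← mul_pow]
  norm_num
  congr 1
  ring

theorem sum_neg_one_pow_mul_choose (m n : ℤ) (d : ℕ) :
    ∑ p ∈ antidiagonal d,
      (-1 : ℤ) ^ p.1 * Ring.choose m p.1 * Ring.choose (m + n - p.1) p.2 = Ring.choose n d := by
  have h := choose_sub_one_eq n d
  have h2 : Ring.choose n d = (-1 : ℤ) ^ d * Ring.choose (d - n - 1) d := by
    rw [h, ← mul_assoc, ← mul_pow]; norm_num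
  rw [h2, show ((d : ℤ) - n - 1) = m + (d - m - n - 1) by ring, ← choose_vandermonde,
    Finset.mul_sum]
  refine Finset.sum_congr rfl fun p hp => ?_
  rw [mem_antidiagonal] at hp
  have e := choose_sub_one_eq (m + n - p.1) p.2
  have e2 : ((p.2 : ℤ) - (m + n - p.1) - 1) = (d - m - n - 1) := by rw [← hp]; push_cast; ring
  rw [e2] at e
  rw [e, ← hp, pow_add]
  have : (-1 : ℤ) ^ p.2 * (-1) ^ p.2 = 1 := by rw [← mul_pow]; norm_num
  linear_combination (-(-1 : ℤ) ^ p.1 * Ring.choose m p.1 * Ring.choose (m + n - p.1) p.2) * this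

theorem sum_choose_mul_choose_sub (m n : ℤ) (r j : ℕ) :
    ∑ p ∈ antidiagonal r,
      Ring.choose m p.1 * Ring.choose n p.2 * Ring.choose (m - p.1) j =
        Ring.choose m j * Ring.choose (m + n - j) r := by
  rw [show m + n - j = (m - j) + n by ring, ← choose_vandermonde, Finset.mul_sum]
  refine Finset.sum_congr rfl fun p _ => ?_
  linear_combination (Ring.choose n p.2) * choose_mul_choose_sub_comm m p.1 j

theorem neg_one_pow_mul_self (n : ℕ) : (-1 : ℤ) ^ n * (-1) ^ n = 1 := by
  rw [← mul_pow]; norm_num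

/-! ### Brackets of modes in a conformal algebra -/

namespace ConformalStructure

variable {k : Type u} [CommRing k] {C : Type v} [AddCommGroup C] [Module k C]
  (S : ConformalStructure k C)

theorem exists_mul_eq_zero (a b : C) : ∃ N : ℕ, ∀ n, N ≤ n → S.mul n a b = 0 := by
  have key : ∀ c : C, c ∈ ⨆ i, S.gr i := fun c => by
    rw [S.internal.submodule_iSup_eq_top]; trivial
  refine Submodule.iSup_induction S.gr (motive := fun a => ∃ N : ℕ, ∀ n, N ≤ n → S.mul n a b = 0)
    (key a) ?_ ⟨0, by simp⟩ ?_
  · intro i a ha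
    refine Submodule.iSup_induction S.gr
      (motive := fun b => ∃ N : ℕ, ∀ n, N ≤ n → S.mul n a b = 0) (key b) ?_ ⟨0, by simp⟩ ?_
    · intro j b hb
      refine ⟨i + j, fun n hn => ?_⟩
      have h := S.mul_mem n i j a b ha hb
      obtain ⟨t, ht⟩ : ∃ t : ℕ, ((i : ℤ) + j - n - 1) = Int.negSucc t :=
        ⟨n - i - j, by rw [Int.negSucc_eq]; omega⟩
      rw [ht] at h
      exact h
    · rintro x y ⟨N, hN⟩ ⟨N', hN'⟩
      refine ⟨max N N', fun n hn => ?_⟩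
      rw [map_add, hN n (le_trans (le_max_left _ _) hn), hN' n (le_trans (le_max_right _ _) hn),
        add_zero]
  · rintro x y ⟨N, hN⟩ ⟨N', hN'⟩
    refine ⟨max N N', fun n hn => ?_⟩
    rw [map_add, LinearMap.add_apply, hN n (le_trans (le_max_left _ _) hn),
      hN' n (le_trans (le_max_right _ _) hn), add_zero]

theorem exists_mul_mul_eq_zero_left (a b c : C) :
    ∃ N : ℕ, ∀ i j, N ≤ i + j → S.mul j (S.mul i a b) c = 0 := by
  obtain ⟨N, hN⟩ := S.exists_mul_eq_zero a b
  choose f hf using fun i => S.exists_mul_eq_zero (S.mul i a b) c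
  refine ⟨N + ∑ i ∈ Finset.range N, f i, fun i j hij => ?_⟩
  by_cases hi : N ≤ i
  · simp [hN i hi]
  · apply hf
    have := Finset.single_le_sum (f := f) (fun _ _ => Nat.zero_le _)
      (Finset.mem_range.2 (not_le.1 hi))
    omega

theorem exists_mul_mul_eq_zero_right (a b c : C) :
    ∃ N : ℕ, ∀ i j, N ≤ i + j → S.mul j a (S.mul i b c) = 0 := by
  obtain ⟨N, hN⟩ := S.exists_mul_eq_zero b c
  choose f hf using fun i => S.exists_mul_eq_zero a (S.mul i b c)
  refine ⟨N + ∑ i ∈ Finset.range N, f i, fun i j hij => ?_⟩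
  by_cases hi : N ≤ i
  · simp [hN i hi]
  · apply hf
    have := Finset.single_le_sum (f := f) (fun _ _ => Nat.zero_le _)
      (Finset.mem_range.2 (not_le.1 hi))
    omega

variable {E : Type w} [AddCommGroup E] [Module k E] {E' : Type*} [AddCommGroup E'] [Module k E']

theorem bracket_sum (φ : ℤ → C →ₗ[k] E) (m n : ℤ) {a b : C} {N : ℕ}
    (hN : ∀ j, N ≤ j → S.mul j a b = 0) :
    ∑ᶠ j : ℕ, Ring.choose m j • φ (m + n - j) (S.mul j a b) =
      ∑ j ∈ Finset.range N, Ring.choose m j • φ (m + n - j) (S.mul j a b) :=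
  finsum_eq_sum_range fun j hj => by rw [hN j hj, map_zero, smul_zero]

/-- The commutator `[a_m, b_n] = ∑_j (m choose j) (a_(j) b)_{m+n-j}` of two modes, with the family
`φ` substituted for the modes: `φ n a` plays the role of `a_n`. -/
noncomputable def bracket (φ : ℤ → C →ₗ[k] E) (m n : ℤ) : C →ₗ[k] C →ₗ[k] E :=
  LinearMap.mk₂ k (fun a b => ∑ᶠ j : ℕ, Ring.choose m j • φ (m + n - j) (S.mul j a b))
    (fun a a' b => by
      obtain ⟨N, hN⟩ := S.exists_mul_eq_zero a b
      obtain ⟨N', hN'⟩ := S.exists_mul_eq_zero a' b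
      rw [S.bracket_sum φ m n fun j hj => hN j (le_trans (le_max_left N N') hj),
        S.bracket_sum φ m n fun j hj => hN' j (le_trans (le_max_right N N') hj),
        S.bracket_sum φ m n (N := max N N') fun j hj => by
          rw [map_add, LinearMap.add_apply, hN j (le_trans (le_max_left N N') hj),
            hN' j (le_trans (le_max_right N N') hj), add_zero], ← Finset.sum_add_distrib]
      simp)
    (fun r a b => by
      obtain ⟨N, hN⟩ := S.exists_mul_eq_zero a b
      rw [S.bracket_sum φ m n hN, S.bracket_sum φ m n (N := N) fun j hj => by
        rw [map_smul, LinearMap.smul_apply, hN j hj, smul_zero], Finset.smul_sum]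
      simp [smul_comm r])
    (fun a b b' => by
      obtain ⟨N, hN⟩ := S.exists_mul_eq_zero a b
      obtain ⟨N', hN'⟩ := S.exists_mul_eq_zero a b'
      rw [S.bracket_sum φ m n fun j hj => hN j (le_trans (le_max_left N N') hj),
        S.bracket_sum φ m n fun j hj => hN' j (le_trans (le_max_right N N') hj),
        S.bracket_sum φ m n (N := max N N') fun j hj => by
          rw [map_add, hN j (le_trans (le_max_left N N') hj),
            hN' j (le_trans (le_max_right N N') hj), add_zero], ← Finset.sum_add_distrib]
      simp)
    (fun r a b => by
      obtain ⟨N, hN⟩ := S.exists_mul_eq_zero a b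
      rw [S.bracket_sum φ m n hN, S.bracket_sum φ m n (N := N) fun j hj => by
        rw [map_smul, hN j hj, smul_zero], Finset.smul_sum]
      simp [smul_comm r])

theorem bracket_def (φ : ℤ → C →ₗ[k] E) (m n : ℤ) (a b : C) :
    S.bracket φ m n a b = ∑ᶠ j : ℕ, Ring.choose m j • φ (m + n - j) (S.mul j a b) := rfl

theorem bracket_eq_sum (φ : ℤ → C →ₗ[k] E) (m n : ℤ) {a b : C} {N : ℕ}
    (hN : ∀ j, N ≤ j → S.mul j a b = 0) :
    S.bracket φ m n a b =
      ∑ j ∈ Finset.range N, Ring.choose m j • φ (m + n - j) (S.mul j a b) :=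
  S.bracket_sum φ m n hN

theorem bracket_comp (g : E →ₗ[k] E') (φ : ℤ → C →ₗ[k] E) (m n : ℤ) (a b : C) :
    S.bracket (fun q => g ∘ₗ φ q) m n a b = g (S.bracket φ m n a b) := by
  obtain ⟨N, hN⟩ := S.exists_mul_eq_zero a b
  simp [S.bracket_eq_sum _ m n hN]

theorem bracket_add (φ φ' : ℤ → C →ₗ[k] E) (m n : ℤ) (a b : C) :
    S.bracket (φ + φ') m n a b = S.bracket φ m n a b + S.bracket φ' m n a b := by
  obtain ⟨N, hN⟩ := S.exists_mul_eq_zero a b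
  simp [S.bracket_eq_sum _ m n hN, Finset.sum_add_distrib]

theorem bracket_smul (r : k) (φ : ℤ → C →ₗ[k] E) (m n : ℤ) (a b : C) :
    S.bracket (r • φ) m n a b = r • S.bracket φ m n a b := by
  obtain ⟨N, hN⟩ := S.exists_mul_eq_zero a b
  simp [S.bracket_eq_sum _ m n hN, Finset.smul_sum, smul_comm r]

/-- A family `φ n : C → E` behaves like the modes `a ↦ a_n`:
`(∂^(i) a)_n = (-1)^i (n choose i) a_{n-i}`. -/
def IsMode (φ : ℤ → C →ₗ[k] E) : Prop :=
  ∀ (n : ℤ) (i : ℕ) (a : C), φ n (S.D i a) = ((-1 : ℤ) ^ i * Ring.choose n i) • φ (n - i) a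

variable {S}

theorem bracket_D_left (φ : ℤ → C →ₗ[k] E) (m n : ℤ) (i : ℕ) (a b : C) :
    S.bracket φ m n (S.D i a) b =
      ((-1 : ℤ) ^ i * Ring.choose m i) • S.bracket φ (m - i) n a b := by
  obtain ⟨N, hN⟩ := S.exists_mul_eq_zero a b
  rw [S.bracket_eq_sum φ _ _ hN, S.bracket_eq_sum φ _ _ (N := i + N) fun j hj => by
    rw [S.mul_D, hN _ (by omega), smul_zero], Finset.sum_range_add, Finset.smul_sum,
    Finset.sum_eq_zero, zero_add]
  · refine Finset.sum_congr rfl fun j _ => ?_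
    rw [S.mul_D, map_zsmul, smul_smul, smul_smul, Nat.add_sub_cancel_left]
    congr 1
    · linear_combination (-1 : ℤ) ^ i * choose_add_mul_choose m i j
    · congr 2; push_cast; ring
  · intro j hj
    rw [S.mul_D, Nat.choose_eq_zero_of_lt (Finset.mem_range.1 hj)]
    simp

/-- Skew-symmetry of the bracket, from the skew-symmetry axiom of `C`. -/
theorem bracket_skew {φ : ℤ → C →ₗ[k] E} (hφ : S.IsMode φ) (m n : ℤ) (a b : C) :
    S.bracket φ m n a b = - S.bracket φ n m b a := by
  obtain ⟨N₁, hN₁⟩ := S.exists_mul_eq_zero a b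
  obtain ⟨N₂, hN₂⟩ := S.exists_mul_eq_zero b a
  set N := max N₁ N₂
  have hN : ∀ j, N ≤ j → S.mul j b a = 0 := fun j hj => hN₂ j (le_trans (le_max_right _ _) hj)
  rw [S.bracket_eq_sum φ _ _ (N := N) fun j hj => hN₁ j (le_trans (le_max_left _ _) hj),
    S.bracket_eq_sum φ _ _ hN]
  have step : ∀ j : ℕ, Ring.choose m j • φ (m + n - j) (S.mul j a b) =
      ∑ i ∈ Finset.range N, (-((-1 : ℤ) ^ j * Ring.choose m j * Ring.choose (m + n - j) i)) •
        φ (m + n - (j + i : ℕ)) (S.mul (j + i) b a) := fun j => by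
    rw [S.mul_comm j a b, finsum_eq_sum_range (N := N) fun i hi => by
      rw [hN _ (by omega), map_zero, smul_zero]]
    simp only [map_zsmul, map_sum, Finset.smul_sum, smul_smul]
    refine Finset.sum_congr rfl fun i _ => ?_
    rw [hφ, smul_smul]
    congr 1
    · rw [pow_succ]
      linear_combination (-Ring.choose m j * (-1 : ℤ) ^ j * Ring.choose (m + n - j) i) *
        neg_one_pow_mul_self i
    · congr 2; push_cast; ring
  rw [Finset.sum_congr rfl fun j _ => step j,
    sum_range_range_eq_sum_antidiagonal (f := fun j i =>
      (-((-1 : ℤ) ^ j * Ring.choose m j * Ring.choose (m + n - j) i)) •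
        φ (m + n - (j + i : ℕ)) (S.mul (j + i) b a))
      fun i j hij => by rw [hN _ hij, map_zero, smul_zero], ← Finset.sum_neg_distrib]
  refine Finset.sum_congr rfl fun d _ => ?_
  rw [← neg_smul, ← sum_neg_one_pow_mul_choose m n d, ← Finset.sum_neg_distrib, Finset.sum_smul]
  refine Finset.sum_congr rfl fun p hp => ?_
  rw [mem_antidiagonal.1 hp, add_comm n m]

theorem bracket_D_right {φ : ℤ → C →ₗ[k] E} (hφ : S.IsMode φ) (m n : ℤ) (i : ℕ) (a b : C) :
    S.bracket φ m n a (S.D i b) =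
      ((-1 : ℤ) ^ i * Ring.choose n i) • S.bracket φ m (n - i) a b := by
  rw [bracket_skew hφ, bracket_D_left, bracket_skew hφ m (n - i), smul_neg]

/-- The coefficients of the Jacobi identity for modes: the commutator axiom of `C`, multiplied by
`(m choose i) (n choose j)` and summed over `i + j = d`. -/
theorem sum_choose_mul_mul (m n : ℤ) (a b c : C) (d : ℕ) :
    ∑ p ∈ antidiagonal d,
      (Ring.choose m p.1 * Ring.choose n p.2) • S.mul p.1 a (S.mul p.2 b c) =
    ∑ p ∈ antidiagonal d,
      (Ring.choose m p.1 * Ring.choose n p.2) • S.mul p.2 b (S.mul p.1 a c) +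
    ∑ p ∈ antidiagonal d,
      (Ring.choose m p.1 * Ring.choose (m + n - p.1) p.2) • S.mul p.2 (S.mul p.1 a b) c := by
  have h1 : ∀ j i : ℕ, S.mul j a (S.mul i b c) = S.mul i b (S.mul j a c) +
      ∑ q ∈ antidiagonal j, j.choose q.1 • S.mul (q.2 + i) (S.mul q.1 a b) c := by
    intro j i
    rw [S.mul_mul, Finset.Nat.sum_antidiagonal_eq_sum_range_succ_mk]
    congr 1
    refine Finset.sum_congr rfl fun q hq => ?_
    rw [Finset.mem_range] at hq
    simp only
    congr 3
    rw [show j + i - q = j - q + i by omega]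
  simp only [h1, smul_add, Finset.sum_add_distrib, Finset.smul_sum]
  congr 1
  have h2 := sum_antidiagonal_assoc (fun s j i =>
    (Ring.choose m (s + j) * Ring.choose n i) • (s + j).choose s •
      S.mul (j + i) (S.mul s a b) c) d
  refine Eq.trans (Eq.trans ?_ h2) ?_
  · refine Finset.sum_congr rfl fun p _ => Finset.sum_congr rfl fun q hq => ?_
    rw [mem_antidiagonal.1 hq]
  · refine Finset.sum_congr rfl fun p _ => ?_
    rw [show m + n - p.1 = (m - p.1) + n by ring, ← choose_vandermonde, Finset.mul_sum,
      Finset.sum_smul]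
    refine Finset.sum_congr rfl fun q hq => ?_
    rw [mem_antidiagonal.1 hq, ← natCast_zsmul, smul_smul]
    congr 1
    linear_combination (Ring.choose n q.2) * choose_add_mul_choose m p.1 q.1

/-- The Jacobi identity `[a_m, [b_n, c_p]] = [b_n, [a_m, c_p]] + [[a_m, b_n], c_p]`. -/
theorem bracket_jacobi (φ : ℤ → C →ₗ[k] E) (m n p : ℤ) (a b c : C) :
    S.bracket (fun q => S.bracket φ m q a) n p b c =
      S.bracket (fun q => S.bracket φ n q b) m p a c +
        S.bracket (fun q => (S.bracket φ q p).flip c) m n a b := by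
  obtain ⟨N₁, h₁⟩ := S.exists_mul_mul_eq_zero_right a b c
  obtain ⟨N₂, h₂⟩ := S.exists_mul_mul_eq_zero_right b a c
  obtain ⟨N₃, h₃⟩ := S.exists_mul_mul_eq_zero_left a b c
  obtain ⟨M₁, k₁⟩ := S.exists_mul_eq_zero b c
  obtain ⟨M₂, k₂⟩ := S.exists_mul_eq_zero a c
  obtain ⟨M₃, k₃⟩ := S.exists_mul_eq_zero a b
  obtain ⟨N, hN⟩ : ∃ N, N₁ ≤ N ∧ N₂ ≤ N ∧ N₃ ≤ N ∧ M₁ ≤ N ∧ M₂ ≤ N ∧ M₃ ≤ N :=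
    ⟨N₁ + N₂ + N₃ + M₁ + M₂ + M₃, by omega⟩
  have e₁ : S.bracket (fun q => S.bracket φ m q a) n p b c = ∑ d ∈ Finset.range N,
      φ (m + n + p - d) (∑ q ∈ antidiagonal d,
        (Ring.choose m q.1 * Ring.choose n q.2) • S.mul q.1 a (S.mul q.2 b c)) := by
    rw [S.bracket_eq_sum _ _ _ (N := N) fun j hj => k₁ j (by omega)]
    have : ∀ i, S.bracket φ m (n + p - (i : ℕ)) a (S.mul i b c) = ∑ j ∈ Finset.range N,
        Ring.choose m j • φ (m + (n + p - i) - j) (S.mul j a (S.mul i b c)) := fun i =>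
      S.bracket_eq_sum _ _ _ fun j hj => h₁ i j (by omega)
    simp only [this, Finset.smul_sum]
    rw [Finset.sum_comm, sum_range_range_eq_sum_antidiagonal (f := fun j i =>
      Ring.choose n i • Ring.choose m j • φ (m + (n + p - i) - j) (S.mul j a (S.mul i b c)))
      fun j i hij => by rw [h₁ i j (by omega), map_zero, smul_zero, smul_zero]]
    refine Finset.sum_congr rfl fun d _ => ?_
    rw [map_sum]
    refine Finset.sum_congr rfl fun q hq => ?_
    rw [map_zsmul, smul_smul, _root_.mul_comm, ← mem_antidiagonal.1 hq,
      show m + (n + p - (q.2 : ℤ)) - q.1 = m + n + p - (q.1 + q.2 : ℕ) by push_cast; ring]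
  have e₂ : S.bracket (fun q => S.bracket φ n q b) m p a c = ∑ d ∈ Finset.range N,
      φ (m + n + p - d) (∑ q ∈ antidiagonal d,
        (Ring.choose m q.1 * Ring.choose n q.2) • S.mul q.2 b (S.mul q.1 a c)) := by
    rw [S.bracket_eq_sum _ _ _ (N := N) fun j hj => k₂ j (by omega)]
    have : ∀ i, S.bracket φ n (m + p - (i : ℕ)) b (S.mul i a c) = ∑ j ∈ Finset.range N,
        Ring.choose n j • φ (n + (m + p - i) - j) (S.mul j b (S.mul i a c)) := fun i =>
      S.bracket_eq_sum _ _ _ fun j hj => h₂ i j (by omega)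
    simp only [this, Finset.smul_sum]
    rw [sum_range_range_eq_sum_antidiagonal (f := fun i j =>
      Ring.choose m i • Ring.choose n j • φ (n + (m + p - i) - j) (S.mul j b (S.mul i a c)))
      fun i j hij => by rw [h₂ i j (by omega), map_zero, smul_zero, smul_zero]]
    refine Finset.sum_congr rfl fun d _ => ?_
    rw [map_sum]
    refine Finset.sum_congr rfl fun q hq => ?_
    rw [map_zsmul, smul_smul, ← mem_antidiagonal.1 hq]
    congr 3
    push_cast; ring
  have e₃ : S.bracket (fun q => (S.bracket φ q p).flip c) m n a b = ∑ d ∈ Finset.range N,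
      φ (m + n + p - d) (∑ q ∈ antidiagonal d,
        (Ring.choose m q.1 * Ring.choose (m + n - q.1) q.2) • S.mul q.2 (S.mul q.1 a b) c) := by
    rw [S.bracket_eq_sum _ _ _ (N := N) fun j hj => k₃ j (by omega)]
    have : ∀ i, (S.bracket φ (m + n - (i : ℕ)) p).flip c (S.mul i a b) = ∑ j ∈ Finset.range N,
        Ring.choose (m + n - i) j • φ (m + n - i + p - j) (S.mul j (S.mul i a b) c) := fun i =>
      S.bracket_eq_sum _ _ _ fun j hj => h₃ i j (by omega)
    simp only [this, Finset.smul_sum]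
    rw [sum_range_range_eq_sum_antidiagonal (f := fun i j =>
      Ring.choose m i • Ring.choose (m + n - i) j •
        φ (m + n - i + p - j) (S.mul j (S.mul i a b) c))
      fun i j hij => by rw [h₃ i j (by omega), map_zero, smul_zero, smul_zero]]
    refine Finset.sum_congr rfl fun d _ => ?_
    rw [map_sum]
    refine Finset.sum_congr rfl fun q hq => ?_
    rw [map_zsmul, smul_smul, ← mem_antidiagonal.1 hq]
    congr 3
    push_cast; ring
  rw [e₁, e₂, e₃, ← Finset.sum_add_distrib]
  refine Finset.sum_congr rfl fun d _ => ?_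
  rw [sum_choose_mul_mul, map_add]

end ConformalStructure

namespace ConformalStructure

variable {k : Type u} [CommRing k] {C : Type v} [AddCommGroup C] [Module k C]
  {S : ConformalStructure k C} {E : Type w} [AddCommGroup E] [Module k E]

/-! ### Translation and the bracket on a conformal algebra -/

theorem IsMode.neg_one_sub {φ : ℤ → C →ₗ[k] E} (hφ : S.IsMode φ) (j : ℕ) (a : C) :
    φ (-1 - j) a = φ (-1) (S.D j a) := by
  have hc : Ring.choose (-1 : ℤ) j = (-1) ^ j := by
    simpa using VertexStructure.choose_neg_one_sub 0 j
  rw [hφ, hc, neg_one_pow_mul_self, one_smul]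

/-- The family of the modes `a_n`, applied to the vacuum: `a_{-1-j} 1` corresponds to `∂^(j) a`,
and `a_n 1 = 0` for `n ≥ 0`. -/
def vacMode (S : ConformalStructure k C) : ℤ → C →ₗ[k] C
  | Int.ofNat _ => 0
  | Int.negSucc j => S.D j

theorem vacMode_of_nonneg {n : ℤ} (hn : 0 ≤ n) : S.vacMode n = 0 := by
  obtain ⟨m, rfl⟩ := Int.eq_ofNat_of_zero_le hn
  rfl

theorem vacMode_neg_one_sub (j : ℕ) : S.vacMode (-1 - j) = S.D j := by
  rw [show (-1 - (j : ℤ)) = Int.negSucc j by rw [Int.negSucc_eq]; ring]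
  rfl

theorem isMode_vacMode : S.IsMode S.vacMode := by
  intro n i a
  rcases le_or_gt 0 n with hn | hn
  · rw [vacMode_of_nonneg hn, LinearMap.zero_apply]
    rcases le_or_gt 0 (n - i) with hi | hi
    · rw [vacMode_of_nonneg hi, LinearMap.zero_apply, smul_zero]
    · obtain ⟨m, rfl⟩ := Int.eq_ofNat_of_zero_le hn
      rw [Ring.choose_natCast, Nat.choose_eq_zero_of_lt (by omega)]
      simp
  · obtain ⟨j, rfl⟩ : ∃ j : ℕ, n = -1 - j := ⟨(-1 - n).toNat, by omega⟩
    rw [show (-1 - (j : ℤ) - i) = -1 - (j + i : ℕ) by push_cast; ring, vacMode_neg_one_sub,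
      vacMode_neg_one_sub, S.D_comp, VertexStructure.choose_neg_one_sub, ← mul_assoc,
      neg_one_pow_mul_self, one_mul, natCast_zsmul, Nat.choose_symm_add]

theorem vacMode_D (n : ℤ) (i : ℕ) (a : C) : S.vacMode n (S.D i a) = S.D i (S.vacMode n a) := by
  rcases le_or_gt 0 n with hn | hn
  · simp [vacMode_of_nonneg hn]
  · obtain ⟨j, rfl⟩ : ∃ j : ℕ, n = -1 - j := ⟨(-1 - n).toNat, by omega⟩
    rw [vacMode_neg_one_sub, S.D_comp, S.D_comp, add_comm i j, Nat.choose_symm_add]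

/-- The bracket is compatible with the Leibniz rule for `∂^(r)`. -/
theorem bracket_D_D {φ : ℤ → C →ₗ[k] E} (hφ : S.IsMode φ) (m n : ℤ) (r : ℕ) (a b : C) :
    ∑ p ∈ antidiagonal r, S.bracket φ m n (S.D p.1 a) (S.D p.2 b) =
      S.bracket (fun q => φ q ∘ₗ S.D r) m n a b := by
  obtain ⟨N, hN⟩ := S.exists_mul_eq_zero a b
  simp only [bracket_D_left, bracket_D_right hφ, S.bracket_eq_sum _ _ _ hN, smul_smul,
    Finset.smul_sum]
  rw [Finset.sum_comm]
  refine Finset.sum_congr rfl fun j _ => ?_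
  rw [LinearMap.comp_apply, hφ, smul_smul, show Ring.choose m j * ((-1 : ℤ) ^ r *
    Ring.choose (m + n - j) r) = (-1 : ℤ) ^ r * (Ring.choose m j * Ring.choose (m + n - j) r) by
    ring, ← sum_choose_mul_choose_sub, Finset.mul_sum, Finset.sum_smul]
  refine Finset.sum_congr rfl fun p hp => ?_
  rw [← mem_antidiagonal.1 hp, pow_add]
  congr 1
  · ring
  · congr 2; push_cast; ring

/-- The bracket `[x, y] = ∑_j (-1)^j ∂^(j+1) (x_(j) y)` on `C`. -/
noncomputable def lie (S : ConformalStructure k C) (x y : C) : C :=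
  ∑ᶠ j : ℕ, (-1 : ℤ) ^ j • S.D (j + 1) (S.mul j x y)

theorem bracket_neg_one_neg_one {φ : ℤ → C →ₗ[k] E} (hφ : S.IsMode φ) (x y : C) :
    S.bracket φ (-1) (-1) x y = φ (-1) (S.lie x y) := by
  obtain ⟨N, hN⟩ := S.exists_mul_eq_zero x y
  rw [S.bracket_eq_sum _ _ _ hN, lie, finsum_eq_sum_range (N := N) fun j hj => by
    rw [hN j hj, map_zero, smul_zero], map_sum]
  refine Finset.sum_congr rfl fun j _ => ?_
  rw [map_zsmul, ← hφ.neg_one_sub, show (-1 + -1 - (j : ℤ)) = -1 - (j + 1 : ℕ) by push_cast; ring]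
  congr 1
  simpa using VertexStructure.choose_neg_one_sub 0 j

theorem lie_eq_bracket (x y : C) : S.lie x y = S.bracket S.vacMode (-1) (-1) x y := by
  have h := S.D_zero (S.lie x y)
  rw [← vacMode_neg_one_sub, Nat.cast_zero, sub_zero] at h
  rw [bracket_neg_one_neg_one isMode_vacMode, h]

/-- The operators `∂^(r)` are the divided powers of a derivation of the bracket on `C`. -/
theorem sum_lie_D (r : ℕ) (x y : C) :
    ∑ p ∈ antidiagonal r, S.lie (S.D p.1 x) (S.D p.2 y) = S.D r (S.lie x y) := by
  simp only [lie_eq_bracket]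
  rw [bracket_D_D isMode_vacMode, ← bracket_comp]
  congr 3
  funext q
  ext a
  exact vacMode_D q r a

/-! ### The algebra `UC` -/

theorem relator_eq (x y : C) : S.relator x y = TensorAlgebra.ι k x * TensorAlgebra.ι k y -
    TensorAlgebra.ι k y * TensorAlgebra.ι k x - TensorAlgebra.ι k (S.lie x y) := rfl

theorem proj_eq_zero {t : TensorAlgebra k C} (ht : t ∈ S.relIdeal) : S.proj t = 0 := by
  have : S.relIdeal.ringCon t 0 := by rwa [TwoSidedIdeal.rel_iff, sub_zero]
  exact (RingCon.eq _).2 this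

theorem proj_surjective : Function.Surjective S.proj := RingCon.mkₐ_surjective S.relIdeal.ringCon

/-- The defining relation of `UC`. -/
theorem incl_mul_sub (x y : C) :
    S.incl x * S.incl y - S.incl y * S.incl x = S.incl (S.lie x y) := by
  have h : S.proj (S.relator x y) = 0 :=
    proj_eq_zero (TwoSidedIdeal.subset_span ⟨x, y, rfl⟩)
  rw [relator_eq, map_sub, map_sub, map_mul, map_mul, sub_eq_zero] at h
  exact h

/-- The universal property of `UC` as an associative algebra. -/
noncomputable def envelopeLift {A : Type*} [Ring A] [Algebra k A] (f : C →ₗ[k] A)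
    (hf : ∀ x y, f x * f y - f y * f x = f (S.lie x y)) : S.Envelope →ₐ[k] A :=
  RingCon.liftₐ S.relIdeal.ringCon (TensorAlgebra.lift k f) (by
    have h : S.relIdeal ≤ TwoSidedIdeal.ker (TensorAlgebra.lift k f) := by
      refine TwoSidedIdeal.span_le.2 ?_
      rintro _ ⟨x, y, rfl⟩
      rw [SetLike.mem_coe, TwoSidedIdeal.mem_ker, relator_eq]
      simp [hf]
    intro a b hab
    rw [TwoSidedIdeal.rel_iff] at hab
    have := (TwoSidedIdeal.mem_ker _).1 (h hab)
    rw [map_sub, sub_eq_zero] at this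
    exact this)

theorem envelopeLift_incl {A : Type*} [Ring A] [Algebra k A] (f : C →ₗ[k] A)
    (hf : ∀ x y, f x * f y - f y * f x = f (S.lie x y)) (x : C) :
    envelopeLift f hf (S.incl x) = f x := by
  refine (RingCon.liftₐ_mk _ _ _ _).trans ?_
  simp

/-- `UC` is generated by `1` under the left multiplications by elements of `C`. -/
@[elab_as_elim]
theorem envelope_induction {P : S.Envelope → Prop} (one : P 1)
    (add : ∀ a b, P a → P b → P (a + b)) (smul : ∀ (r : k) a, P a → P (r • a))
    (mul : ∀ x z, P z → P (S.incl x * z)) (z : S.Envelope) : P z := by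
  obtain ⟨t, rfl⟩ := proj_surjective z
  suffices h : ∀ z, P z → P (S.proj t * z) by simpa using h 1 one
  induction t using TensorAlgebra.induction with
  | algebraMap r =>
    intro z hz
    rw [AlgHom.commutes, ← Algebra.smul_def]
    exact smul r z hz
  | ι x => exact fun z hz => mul x z hz
  | mul a b ha hb =>
    intro z hz
    rw [map_mul, mul_assoc]
    exact ha _ (hb _ hz)
  | add a b ha hb =>
    intro z hz
    rw [map_add, add_mul]
    exact add _ _ (ha z hz) (hb z hz)

/-! ### The modes of elements of `C` on `UC` -/

variable (S)

/-- The pairs `(z, φ)` of an element `z` of `UC` and a family `φ n x` of candidates for the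
elements `x_n z`. -/
def modeModule : Submodule k (S.Envelope × (ℤ → C →ₗ[k] S.Envelope)) where
  carrier := {p | S.IsMode p.2 ∧ ∀ a, p.2 (-1) a = S.incl a * p.1}
  zero_mem' := ⟨fun n i a => by simp, fun a => by simp⟩
  add_mem' := by
    rintro p q ⟨hp, hp'⟩ ⟨hq, hq'⟩
    exact ⟨fun n i a => by simp [hp n i a, hq n i a], fun a => by simp [hp' a, hq' a, mul_add]⟩
  smul_mem' := by
    rintro r p ⟨hp, hp'⟩
    exact ⟨fun n i a => by simp [hp n i a], fun a => by simp [hp' a]⟩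

variable {S}

variable (S) in
/-- The type of the elements of `modeModule`, with its structure of a `k`-module. -/
def ModeModule : Type (max u v) := S.modeModule

noncomputable instance : AddCommGroup S.ModeModule := Submodule.addCommGroup S.modeModule

noncomputable instance : Module k S.ModeModule := Submodule.module S.modeModule

variable (S) in
/-- The component `z` of a pair `(z, φ)`. -/
noncomputable def ModeModule.fst : S.ModeModule →ₗ[k] S.Envelope :=
  LinearMap.fst k _ _ ∘ₗ S.modeModule.subtype

variable (S) in
/-- The component `φ` of a pair `(z, φ)`. -/
noncomputable def ModeModule.snd : S.ModeModule →ₗ[k] (ℤ → C →ₗ[k] S.Envelope) :=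
  LinearMap.snd k _ _ ∘ₗ S.modeModule.subtype

namespace ModeModule

theorem ext {p q : S.ModeModule} (h₁ : fst S p = fst S q)
    (h₂ : ∀ n x, snd S p n x = snd S q n x) : p = q :=
  Subtype.ext (Prod.ext h₁ (funext fun n => LinearMap.ext (h₂ n)))

theorem isMode_snd (p : S.ModeModule) : S.IsMode (snd S p) := p.2.1

theorem snd_neg_one (p : S.ModeModule) (x : C) : snd S p (-1) x = S.incl x * fst S p := p.2.2 x

/-- The element of `ModeModule` with given components. -/
def mk (z : S.Envelope) (φ : ℤ → C →ₗ[k] S.Envelope) (h : (z, φ) ∈ S.modeModule) :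
    S.ModeModule := ⟨(z, φ), h⟩

theorem fst_mk (z : S.Envelope) (φ : ℤ → C →ₗ[k] S.Envelope) (h : (z, φ) ∈ S.modeModule) :
    fst S (mk z φ h) = z := rfl

theorem snd_mk (z : S.Envelope) (φ : ℤ → C →ₗ[k] S.Envelope) (h : (z, φ) ∈ S.modeModule) :
    snd S (mk z φ h) = φ := rfl

end ModeModule

open ModeModule

/-- The family `x ↦ x_n (y z)`, obtained from the family `φ n x = x_n z` by commuting `x_n` with
`y = y_{-1}`. -/
noncomputable def mulFamily (y : C) (φ : ℤ → C →ₗ[k] S.Envelope) : ℤ → C →ₗ[k] S.Envelope :=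
  fun n => LinearMap.mulLeft k (S.incl y) ∘ₗ φ n + (S.bracket φ n (-1)).flip y

theorem mulFamily_apply (y : C) (φ : ℤ → C →ₗ[k] S.Envelope) (n : ℤ) (x : C) :
    mulFamily y φ n x = S.incl y * φ n x + S.bracket φ n (-1) x y := rfl

theorem mul_mem_modeModule (y : C) (p : S.ModeModule) :
    (S.incl y * fst S p, mulFamily y (snd S p)) ∈ S.modeModule := by
  refine ⟨fun n i a => ?_, fun a => ?_⟩
  · simp only [mulFamily_apply, isMode_snd p n i a, bracket_D_left, smul_add, mul_smul_comm]
  · simp only [mulFamily_apply, bracket_neg_one_neg_one (isMode_snd p), snd_neg_one]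
    rw [← incl_mul_sub, ← mul_assoc, ← mul_assoc, sub_mul]
    abel

/-- The left multiplications by elements of `C` on the pairs `(z, φ)`. -/
noncomputable def modeAction (S : ConformalStructure k C) : C →ₗ[k] Module.End k S.ModeModule :=
  LinearMap.mk₂ k (fun y p => ModeModule.mk _ _ (mul_mem_modeModule y p))
    (fun y y' p => by
      refine ModeModule.ext ?_ fun n x => ?_
      · simp only [map_add, fst_mk, add_mul]
      · simp only [map_add, snd_mk, mulFamily_apply, Pi.add_apply, LinearMap.add_apply, add_mul]
        abel)
    (fun r y p => by
      refine ModeModule.ext ?_ fun n x => ?_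
      · simp only [map_smul, fst_mk, smul_mul_assoc]
      · simp only [map_smul, snd_mk, mulFamily_apply, Pi.smul_apply, LinearMap.smul_apply,
          smul_mul_assoc, smul_add])
    (fun y p p' => by
      refine ModeModule.ext ?_ fun n x => ?_
      · simp only [map_add, fst_mk, mul_add]
      · simp only [map_add, snd_mk, mulFamily_apply, Pi.add_apply, LinearMap.add_apply, mul_add,
          bracket_add]
        abel)
    (fun r y p => by
      refine ModeModule.ext ?_ fun n x => ?_
      · simp only [map_smul, fst_mk, mul_smul_comm]
      · simp only [map_smul, snd_mk, mulFamily_apply, Pi.smul_apply, LinearMap.smul_apply,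
          mul_smul_comm, smul_add, bracket_smul])

theorem fst_modeAction (y : C) (p : S.ModeModule) :
    fst S (S.modeAction y p) = S.incl y * fst S p := rfl

theorem snd_modeAction (y : C) (p : S.ModeModule) :
    snd S (S.modeAction y p) = mulFamily y (snd S p) := rfl

theorem bracket_mulFamily (v : C) (φ : ℤ → C →ₗ[k] S.Envelope) (m n : ℤ) (x y : C) :
    S.bracket (mulFamily v φ) m n x y = S.incl v * S.bracket φ m n x y +
      S.bracket (fun q => (S.bracket φ q (-1)).flip v) m n x y := by
  rw [← LinearMap.mulLeft_apply (R := k), ← bracket_comp, ← bracket_add]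
  rfl

theorem bracket_isMode_right {φ : ℤ → C →ₗ[k] E} (hφ : S.IsMode φ) (n : ℤ) (x : C) :
    S.IsMode fun q => S.bracket φ n q x :=
  fun q i a => bracket_D_right hφ n q i x a

/-- The left multiplications on the pairs `(z, φ)` respect the relations of `UC`. Therefore `UC`
acts on these pairs, and the orbit of the pair `(1, x ↦ x_n 1)` gives the modes `x_n` on all of
`UC`. -/
theorem modeAction_mul_sub (u v : C) :
    S.modeAction u * S.modeAction v - S.modeAction v * S.modeAction u =
      S.modeAction (S.lie u v) := by
  refine LinearMap.ext fun p => ModeModule.ext ?_ fun n x => ?_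
  · simp only [LinearMap.sub_apply, Module.End.mul_apply, map_sub, fst_modeAction]
    rw [← incl_mul_sub, sub_mul, mul_assoc, mul_assoc]
  · have hφ := isMode_snd p
    simp only [LinearMap.sub_apply, Module.End.mul_apply, map_sub, snd_modeAction, Pi.sub_apply,
      mulFamily_apply, bracket_mulFamily]
    set φ := snd S p
    have hJ := S.bracket_jacobi φ n (-1) (-1) x u v
    rw [bracket_neg_one_neg_one (bracket_isMode_right hφ n x)] at hJ
    have hs : S.bracket (fun q => S.bracket φ (-1) q u) n (-1) x v =
        - S.bracket (fun q => (S.bracket φ q (-1)).flip u) n (-1) x v := by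
      have h := S.bracket_comp (-LinearMap.id) (fun q => (S.bracket φ q (-1)).flip u) n (-1) x v
      rw [LinearMap.neg_apply, LinearMap.id_apply] at h
      rw [← h]
      congr 3
      funext q
      ext c
      exact bracket_skew hφ (-1) q u c
    rw [hJ, hs, ← incl_mul_sub, mul_add, mul_add, sub_mul, mul_assoc, mul_assoc]
    abel

/-- The vacuum together with the family `x_n 1`. -/
noncomputable def modeVac (S : ConformalStructure k C) : S.ModeModule :=
  ModeModule.mk 1 (fun n => S.incl ∘ₗ S.vacMode n) ⟨fun n i a => by
    simp only [LinearMap.comp_apply, isMode_vacMode n i a, map_zsmul], fun a => by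
    have h : S.vacMode (-1) a = a := by
      simpa using LinearMap.congr_fun (S.vacMode_neg_one_sub 0) a |>.trans (S.D_zero a)
    simp [h]⟩

/-- The pair of `z` and the family of all `x_n z`. -/
noncomputable def modePair (S : ConformalStructure k C) : S.Envelope →ₗ[k] S.ModeModule :=
  LinearMap.applyₗ S.modeVac ∘ₗ (envelopeLift S.modeAction modeAction_mul_sub).toLinearMap

theorem modePair_one : S.modePair 1 = S.modeVac := by
  simp [modePair]

theorem modePair_incl_mul (y : C) (z : S.Envelope) :
    S.modePair (S.incl y * z) = S.modeAction y (S.modePair z) := by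
  simp [modePair, envelopeLift_incl]

theorem fst_modePair (z : S.Envelope) : fst S (S.modePair z) = z := by
  induction z using envelope_induction with
  | one => rw [modePair_one]; rfl
  | add a b ha hb => rw [map_add, map_add, ha, hb]
  | smul r a ha => rw [map_smul, map_smul, ha]
  | mul x z hz => rw [modePair_incl_mul, fst_modeAction, hz]

/-- The operators `x_n` on `UC`, for `x` in `C` and `n : ℤ`. -/
noncomputable def mode (S : ConformalStructure k C) (n : ℤ) : C →ₗ[k] Module.End k S.Envelope :=
  LinearMap.mk₂ k (fun x z => snd S (S.modePair z) n x) (by simp) (by simp) (by simp) (by simp)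

theorem mode_apply (n : ℤ) (x : C) (z : S.Envelope) : S.mode n x z = snd S (S.modePair z) n x := rfl

theorem isMode_mode : S.IsMode S.mode := fun n i a => by
  ext z
  exact isMode_snd (S.modePair z) n i a

theorem mode_neg_one (x : C) (z : S.Envelope) : S.mode (-1) x z = S.incl x * z := by
  rw [mode_apply, snd_neg_one, fst_modePair]

theorem mode_one (n : ℤ) (x : C) : S.mode n x 1 = S.incl (S.vacMode n x) := by
  rw [mode_apply, modePair_one]
  rfl

theorem mode_one_of_nonneg {n : ℤ} (hn : 0 ≤ n) (x : C) : S.mode n x 1 = 0 := by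
  rw [mode_one, vacMode_of_nonneg hn, LinearMap.zero_apply, map_zero]

theorem bracket_mode_apply (m n : ℤ) (x y : C) (z : S.Envelope) :
    S.bracket S.mode m n x y z = S.bracket (snd S (S.modePair z)) m n x y := by
  have h := S.bracket_comp (LinearMap.applyₗ (R := k) z) S.mode m n x y
  rw [LinearMap.applyₗ_apply_apply] at h
  rw [← h]
  rfl

theorem mode_incl_mul (n : ℤ) (x y : C) (z : S.Envelope) :
    S.mode n x (S.incl y * z) = S.incl y * S.mode n x z + S.bracket S.mode n (-1) x y z := by
  rw [mode_apply, modePair_incl_mul, snd_modeAction, mulFamily_apply, bracket_mode_apply]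
  rfl

theorem bracket_mode_incl_mul (m n : ℤ) (x y c : C) (z : S.Envelope) :
    S.bracket S.mode m n x y (S.incl c * z) = S.incl c * S.bracket S.mode m n x y z +
      S.bracket (fun q => (S.bracket S.mode q (-1)).flip c) m n x y z := by
  obtain ⟨N, hN⟩ := S.exists_mul_eq_zero x y
  simp only [S.bracket_eq_sum _ _ _ hN, LinearMap.sum_apply, LinearMap.smul_apply, mode_incl_mul,
    Finset.mul_sum, ← Finset.sum_add_distrib, smul_add, mul_smul_comm, LinearMap.flip_apply]

theorem mode_comm_of_neg (n : ℤ) (j : ℕ) (x y : C) (z : S.Envelope) :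
    S.mode n x (S.mode (-1 - j) y z) =
      S.mode (-1 - j) y (S.mode n x z) + S.bracket S.mode n (-1 - j) x y z := by
  rw [isMode_mode.neg_one_sub, mode_neg_one, mode_neg_one, mode_incl_mul,
    (bracket_isMode_right isMode_mode n x).neg_one_sub]

theorem bracket_mode_one (n m : ℕ) (x y : C) : S.bracket S.mode n m x y 1 = 0 := by
  obtain ⟨N, hN⟩ := S.exists_mul_eq_zero x y
  rw [S.bracket_eq_sum _ _ _ hN, LinearMap.sum_apply]
  refine Finset.sum_eq_zero fun j _ => ?_
  rw [LinearMap.smul_apply, Ring.choose_natCast]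
  by_cases hj : j ≤ n
  · rw [mode_one_of_nonneg (by omega), smul_zero]
  · rw [Nat.choose_eq_zero_of_lt (by omega), Nat.cast_zero, zero_smul]

/-- The commutator formula `[x_n, y_m] = ∑_j (n choose j) (x_(j) y)_{n+m-j}` on `UC`. -/
theorem mode_comm (n m : ℤ) (x y : C) (z : S.Envelope) :
    S.mode n x (S.mode m y z) = S.mode m y (S.mode n x z) + S.bracket S.mode n m x y z := by
  induction z using envelope_induction generalizing n m x y with
  | one =>
    rcases le_or_gt 0 m with hm | hm
    · rcases le_or_gt 0 n with hn | hn
      · lift m to ℕ using hm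
        lift n to ℕ using hn
        rw [mode_one_of_nonneg (by positivity), mode_one_of_nonneg (by positivity),
          bracket_mode_one, map_zero, map_zero, add_zero]
      · obtain ⟨j, rfl⟩ : ∃ j : ℕ, n = -1 - j := ⟨(-1 - n).toNat, by omega⟩
        rw [mode_comm_of_neg m j y x, bracket_skew isMode_mode m, LinearMap.neg_apply,
          neg_add_cancel_right]
    · obtain ⟨j, rfl⟩ : ∃ j : ℕ, m = -1 - j := ⟨(-1 - m).toNat, by omega⟩
      exact mode_comm_of_neg n j x y 1
  | add a b ha hb =>
    rw [map_add, map_add, map_add, map_add, map_add, ha, hb]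
    abel
  | smul r a ha => rw [map_smul, map_smul, map_smul, map_smul, map_smul, ha, smul_add]
  | mul c z hz =>
    have hb : ∀ (n m : ℤ) (x y : C), S.mode n x (S.bracket S.mode m (-1) y c z) =
        S.bracket S.mode m (-1) y c (S.mode n x z) +
          S.bracket (fun q => S.bracket S.mode n q x) m (-1) y c z := fun n m x y => by
      obtain ⟨N, hN⟩ := S.exists_mul_eq_zero y c
      simp only [S.bracket_eq_sum _ m _ hN, LinearMap.sum_apply, LinearMap.smul_apply, map_sum,
        map_zsmul, ← Finset.sum_add_distrib, ← smul_add]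
      exact Finset.sum_congr rfl fun j _ => by rw [hz]
    rw [mode_incl_mul, map_add, mode_incl_mul, hz, hb, mode_incl_mul n, map_add, mode_incl_mul, hb,
      S.bracket_jacobi S.mode n m (-1) x y c, bracket_mode_incl_mul, mul_add, LinearMap.add_apply]
    abel

/-! ### The divided powers of the translation operator on `UC` -/

/-- The homomorphism `UC → UC⟦t⟧` that extends `x ↦ ∑_i ∂^(i) x t^i`. -/
noncomputable def translation (S : ConformalStructure k C) :
    S.Envelope →ₐ[k] PowerSeries S.Envelope :=
  envelopeLift
    { toFun := fun x => PowerSeries.mk fun i => S.incl (S.D i x)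
      map_add' := fun x y => by ext; simp
      map_smul' := fun r x => by ext; simp }
    (fun x y => by
      ext r
      simp only [LinearMap.coe_mk, AddHom.coe_mk, map_sub, PowerSeries.coeff_mul,
        PowerSeries.coeff_mk]
      rw [← Finset.Nat.sum_antidiagonal_swap (n := r)
        (f := fun p => S.incl (S.D p.1 y) * S.incl (S.D p.2 x)), ← Finset.sum_sub_distrib,
        ← sum_lie_D, map_sum]
      exact Finset.sum_congr rfl fun p _ => incl_mul_sub _ _)

/-- The operator `∂^(r)` on `UC`. -/
noncomputable def trans (S : ConformalStructure k C) (r : ℕ) : S.Envelope →ₗ[k] S.Envelope :=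
  (PowerSeries.coeff r : PowerSeries S.Envelope →ₗ[S.Envelope] S.Envelope).restrictScalars k ∘ₗ
    S.translation.toLinearMap

theorem trans_apply (r : ℕ) (z : S.Envelope) :
    S.trans r z = PowerSeries.coeff r (S.translation z) := rfl

theorem trans_one (r : ℕ) : S.trans r 1 = if r = 0 then 1 else 0 := by
  rw [trans_apply, map_one, PowerSeries.coeff_one]

theorem trans_incl (r : ℕ) (x : C) : S.trans r (S.incl x) = S.incl (S.D r x) := by
  rw [trans_apply, translation, envelopeLift_incl]
  simp

theorem trans_incl_mul (r : ℕ) (x : C) (z : S.Envelope) : S.trans r (S.incl x * z) =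
    ∑ p ∈ antidiagonal r, S.incl (S.D p.1 x) * S.trans p.2 z := by
  rw [trans_apply, map_mul, PowerSeries.coeff_mul]
  refine Finset.sum_congr rfl fun p _ => ?_
  rw [← trans_apply, ← trans_apply, trans_incl]

/-- The modes are covariant for the translation operators: `∂^(r) (x_n z)` obeys the Leibniz rule.
-/
theorem trans_mode (r : ℕ) (n : ℤ) (x : C) (z : S.Envelope) : S.trans r (S.mode n x z) =
    ∑ p ∈ antidiagonal r, S.mode n (S.D p.1 x) (S.trans p.2 z) := by
  induction z using envelope_induction generalizing r n x with
  | one =>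
    rw [mode_one, trans_incl, Finset.sum_eq_single (r, 0)]
    · rw [trans_one, if_pos rfl, mode_one, vacMode_D]
    · intro p hp hne
      rw [trans_one, if_neg, map_zero]
      intro h0
      apply hne
      rw [mem_antidiagonal] at hp
      ext <;> simp <;> omega
    · simp [mem_antidiagonal]
  | add a b ha hb => simp only [map_add, ha, hb, Finset.sum_add_distrib]
  | smul r a ha => simp only [map_smul, ha, Finset.smul_sum]
  | mul c z hz =>
    have hb : S.trans r (S.bracket S.mode n (-1) x c z) = ∑ p ∈ antidiagonal r,
        ∑ q ∈ antidiagonal p.1,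
          S.bracket S.mode n (-1) (S.D q.1 x) (S.D q.2 c) (S.trans p.2 z) := by
      simp only [← LinearMap.sum_apply, bracket_D_D isMode_mode]
      obtain ⟨N, hN⟩ := S.exists_mul_eq_zero x c
      simp only [S.bracket_eq_sum _ _ _ hN, LinearMap.sum_apply, LinearMap.smul_apply, map_sum,
        map_zsmul, hz, Finset.smul_sum, LinearMap.comp_apply]
      rw [Finset.sum_comm]
    simp only [trans_incl_mul, map_sum, mode_incl_mul, map_add, hb, hz, Finset.sum_add_distrib,
      Finset.mul_sum]
    congr 1
    · rw [← sum_antidiagonal_assoc (fun i j l => S.incl (S.D i c) *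
        S.mode n (S.D j x) (S.trans l z)), ← sum_antidiagonal_assoc (fun i j l => S.incl (S.D j c) *
        S.mode n (S.D i x) (S.trans l z))]
      refine Finset.sum_congr rfl fun p _ => ?_
      rw [← Finset.Nat.sum_antidiagonal_swap]
      rfl
    · rw [← sum_antidiagonal_assoc (fun i j l =>
        S.bracket S.mode n (-1) (S.D i x) (S.D j c) (S.trans l z))]

end ConformalStructure

/-! ### Multiplication by `(z - w)^n` -/

section Expansion

variable {E : Type*} [AddCommGroup E]

/-- Regard `f : ℤ → ℤ → E` as a formal distribution in `z` and `w`, where `f p q` is the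
coefficient that is extracted by `z^p w^q`. This is the product of `f` with `(z - w)^n`, expanded
in the domain `|z| > |w|`. -/
noncomputable def expand (n : ℤ) (f : ℤ → ℤ → E) (m l : ℤ) : E :=
  ∑ᶠ j : ℕ, ((-1 : ℤ) ^ j * Ring.choose n j) • f (m + n - j) (l + j)

/-- `f p q` vanishes for large `q`, uniformly in `p`. -/
def BddRight (f : ℤ → ℤ → E) : Prop := ∃ Q : ℤ, ∀ p q, Q ≤ q → f p q = 0

theorem BddRight.exists_nat {f : ℤ → ℤ → E} (hf : BddRight f) (l : ℤ) :
    ∃ N : ℕ, ∀ p : ℤ, ∀ j : ℕ, N ≤ j → f p (l + j) = 0 := by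
  obtain ⟨Q, hQ⟩ := hf
  exact ⟨(Q - l).toNat, fun p j hj => hQ _ _ (by omega)⟩

theorem BddRight.add {f g : ℤ → ℤ → E} (hf : BddRight f) (hg : BddRight g) :
    BddRight fun p q => f p q + g p q := by
  obtain ⟨Q, hQ⟩ := hf
  obtain ⟨Q', hQ'⟩ := hg
  exact ⟨max Q Q', fun p q h => by
    simp only [hQ p q (le_trans (le_max_left _ _) h), hQ' p q (le_trans (le_max_right _ _) h),
      add_zero]⟩

theorem BddRight.sub {f g : ℤ → ℤ → E} (hf : BddRight f) (hg : BddRight g) :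
    BddRight fun p q => f p q - g p q := by
  obtain ⟨Q, hQ⟩ := hf
  obtain ⟨Q', hQ'⟩ := hg
  exact ⟨max Q Q', fun p q h => by
    simp only [hQ p q (le_trans (le_max_left _ _) h), hQ' p q (le_trans (le_max_right _ _) h),
      sub_zero]⟩

theorem BddRight.zsmul {f : ℤ → ℤ → E} (hf : BddRight f) (c : ℤ → ℤ → ℤ) :
    BddRight fun p q => c p q • f p q := by
  obtain ⟨Q, hQ⟩ := hf
  exact ⟨Q, fun p q h => by simp only [hQ p q h, smul_zero]⟩

theorem BddRight.shift {f : ℤ → ℤ → E} (hf : BddRight f) (a b : ℤ) :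
    BddRight fun p q => f (p + a) (q + b) := by
  obtain ⟨Q, hQ⟩ := hf
  exact ⟨Q - b, fun p q h => hQ _ _ (by omega)⟩

theorem BddRight.sum {α : Type*} {s : Finset α} {f : α → ℤ → ℤ → E}
    (hf : ∀ i ∈ s, BddRight (f i)) : BddRight fun p q => ∑ i ∈ s, f i p q := by
  classical
  induction s using Finset.induction_on with
  | empty => exact ⟨0, by simp⟩
  | insert a s ha ih =>
    simp only [Finset.sum_insert ha]
    exact (hf a (by simp)).add (ih fun i hi => hf i (by simp [hi]))

theorem expand_eq_sum {n m l : ℤ} {f : ℤ → ℤ → E} {N : ℕ}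
    (h : ∀ p : ℤ, ∀ j : ℕ, N ≤ j → f p (l + j) = 0) :
    expand n f m l =
      ∑ j ∈ Finset.range N, ((-1 : ℤ) ^ j * Ring.choose n j) • f (m + n - j) (l + j) :=
  finsum_eq_sum_range fun j hj => by rw [h _ j hj, smul_zero]

theorem expand_zero (f : ℤ → ℤ → E) (m l : ℤ) : expand 0 f m l = f m l := by
  rw [expand, finsum_eq_single _ 0 fun j hj => by
    rw [Ring.choose_zero_pos ℤ (by omega), mul_zero, zero_smul]]
  simp

theorem expand_map {E' : Type*} [AddCommGroup E'] (g : E →+ E') {f : ℤ → ℤ → E} (hf : BddRight f)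
    (n m l : ℤ) : expand n (fun p q => g (f p q)) m l = g (expand n f m l) := by
  obtain ⟨N, hN⟩ := hf.exists_nat l
  rw [expand_eq_sum hN, expand_eq_sum fun p j hj => by rw [hN p j hj, map_zero], map_sum]
  simp only [map_zsmul]

theorem expand_add {f g : ℤ → ℤ → E} (hf : BddRight f) (hg : BddRight g) (n m l : ℤ) :
    expand n (fun p q => f p q + g p q) m l = expand n f m l + expand n g m l := by
  obtain ⟨N, hN⟩ := hf.exists_nat l
  obtain ⟨N', hN'⟩ := hg.exists_nat l
  rw [expand_eq_sum fun p j hj => hN p j (le_trans (le_max_left N N') hj),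
    expand_eq_sum fun p j hj => hN' p j (le_trans (le_max_right N N') hj),
    expand_eq_sum (N := max N N') fun p j hj => by
      rw [hN p j (le_trans (le_max_left N N') hj), hN' p j (le_trans (le_max_right N N') hj),
        add_zero], ← Finset.sum_add_distrib]
  simp only [smul_add]

theorem expand_sub {f g : ℤ → ℤ → E} (hf : BddRight f) (hg : BddRight g) (n m l : ℤ) :
    expand n (fun p q => f p q - g p q) m l = expand n f m l - expand n g m l := by
  rw [eq_sub_iff_add_eq, ← expand_add (hf.sub hg) hg]
  simp only [sub_add_cancel]

theorem expand_sum {α : Type*} {s : Finset α} {f : α → ℤ → ℤ → E}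
    (hf : ∀ i ∈ s, BddRight (f i)) (n m l : ℤ) :
    expand n (fun p q => ∑ i ∈ s, f i p q) m l = ∑ i ∈ s, expand n (f i) m l := by
  classical
  induction s using Finset.induction_on with
  | empty => simp [expand]
  | insert a s ha ih =>
    simp only [Finset.sum_insert ha]
    rw [expand_add (hf a (by simp)) (BddRight.sum fun i hi => hf i (by simp [hi])),
      ih fun i hi => hf i (by simp [hi])]

/-- `(z - w)^(n+1) = (z - w) (z - w)^n`. -/
theorem expand_succ {f : ℤ → ℤ → E} (hf : BddRight f) (n m l : ℤ) :
    expand (n + 1) f m l = expand n f (m + 1) l - expand n f m (l + 1) := by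
  obtain ⟨N, hN⟩ := hf.exists_nat l
  have hN1 : ∀ p : ℤ, ∀ j : ℕ, N + 1 ≤ j → f p (l + j) = 0 := fun p j hj => hN p j (by omega)
  have hN2 : ∀ p : ℤ, ∀ j : ℕ, N ≤ j → f p (l + 1 + j) = 0 := fun p j hj => by
    have := hN p (j + 1) (by omega)
    rwa [Nat.cast_add, Nat.cast_one, add_comm (j : ℤ) 1, ← add_assoc] at this
  rw [expand_eq_sum hN1, expand_eq_sum hN1, expand_eq_sum hN2, Finset.sum_range_succ',
    Finset.sum_range_succ', show ∀ x y z : E, x + y - z = x - z + y from fun x y z => by abel,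
    ← Finset.sum_sub_distrib]
  congr 1
  · refine Finset.sum_congr rfl fun j _ => ?_
    have hp := Ring.choose_succ_succ n j
    rw [show m + 1 + n - ((j + 1 : ℕ) : ℤ) = m + n - j by push_cast; ring,
      show m + (n + 1) - ((j + 1 : ℕ) : ℤ) = m + n - j by push_cast; ring,
      show l + ((j + 1 : ℕ) : ℤ) = l + 1 + j by push_cast; ring, ← sub_smul, hp, pow_succ]
    congr 1
    ring
  · simp only [pow_zero, Ring.choose_zero_right, mul_one, Nat.cast_zero, one_smul, sub_zero]
    rw [show m + (n + 1) = m + 1 + n by ring]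

theorem bddRight_expand {f : ℤ → ℤ → E} (hf : BddRight f) (n : ℤ) : BddRight (expand n f) := by
  obtain ⟨Q, hQ⟩ := hf
  refine ⟨Q, fun p q h => ?_⟩
  rw [expand_eq_sum (N := 0) fun p' j _ => hQ _ _ (by omega), Finset.sum_range_zero]

/-- Multiplication by `(z - w)^n` is injective on distributions with `BddRight`. -/
theorem BddRight.eq_zero_of_expand_eq_zero {f : ℤ → ℤ → E} (hf : BddRight f) (n : ℤ)
    (h : ∀ m l, expand n f m l = 0) (p q : ℤ) : f p q = 0 := by
  obtain ⟨Q, hQ⟩ := hf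
  suffices H : ∀ d : ℕ, ∀ p q : ℤ, Q ≤ q + d → f p q = 0 from H (Q - q).toNat p q (by omega)
  intro d
  induction d with
  | zero => exact fun p q hq => hQ p q (by simpa using hq)
  | succ d ih =>
    intro p q hq
    have h1 := h (p - n) q
    rw [expand_eq_sum (N := 1) fun p' j hj => ih _ _ (by push_cast at hq; omega)] at h1
    simpa using h1

/-- The coefficient of `t^s` in the image of `f` under the translation of both variables `z` and
`w` by `t`, up to a sign. -/
def biTranslate (s : ℕ) (f : ℤ → ℤ → E) (p q : ℤ) : E :=
  ∑ a ∈ antidiagonal s, (Ring.choose p a.1 * Ring.choose q a.2) • f (p - a.1) (q - a.2)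

theorem bddRight_biTranslate {f : ℤ → ℤ → E} (hf : BddRight f) (s : ℕ) :
    BddRight (biTranslate s f) := by
  obtain ⟨Q, hQ⟩ := hf
  refine ⟨Q + s, fun p q h => Finset.sum_eq_zero fun a ha => ?_⟩
  rw [mem_antidiagonal] at ha
  rw [hQ _ _ (by omega), smul_zero]

theorem biTranslate_shift_left (s : ℕ) (f : ℤ → ℤ → E) (p q : ℤ) :
    biTranslate (s + 1) f (p + 1) q =
      biTranslate (s + 1) (fun p q => f (p + 1) q) p q + biTranslate s f p q := by
  rw [biTranslate, biTranslate, biTranslate, Finset.Nat.sum_antidiagonal_succ,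
    Finset.Nat.sum_antidiagonal_succ, add_assoc, ← Finset.sum_add_distrib]
  congr 1
  · simp
  · refine Finset.sum_congr rfl fun a _ => ?_
    simp only
    rw [Ring.choose_succ_succ, show p + 1 - ((a.1 + 1 : ℕ) : ℤ) = p - a.1 by push_cast; ring,
      show p - ((a.1 + 1 : ℕ) : ℤ) + 1 = p - a.1 by push_cast; ring, ← add_smul]
    congr 1
    ring

theorem biTranslate_shift_right (s : ℕ) (f : ℤ → ℤ → E) (p q : ℤ) :
    biTranslate (s + 1) f p (q + 1) =
      biTranslate (s + 1) (fun p q => f p (q + 1)) p q + biTranslate s f p q := by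
  rw [biTranslate, biTranslate, biTranslate, Finset.Nat.sum_antidiagonal_succ',
    Finset.Nat.sum_antidiagonal_succ', add_assoc, ← Finset.sum_add_distrib]
  congr 1
  · simp
  · refine Finset.sum_congr rfl fun a _ => ?_
    simp only
    rw [Ring.choose_succ_succ, show q + 1 - ((a.2 + 1 : ℕ) : ℤ) = q - a.2 by push_cast; ring,
      show q - ((a.2 + 1 : ℕ) : ℤ) + 1 = q - a.2 by push_cast; ring, ← add_smul]
    congr 1
    ring

/-- `z - w` is invariant under simultaneous translation of `z` and `w`. -/
theorem biTranslate_sub_comm (s : ℕ) (f : ℤ → ℤ → E) (p q : ℤ) :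
    biTranslate s f (p + 1) q - biTranslate s f p (q + 1) =
      biTranslate s (fun p q => f (p + 1) q - f p (q + 1)) p q := by
  have hsub : ∀ g h : ℤ → ℤ → E, biTranslate s (fun p q => g p q - h p q) p q =
      biTranslate s g p q - biTranslate s h p q := fun g h => by
    simp only [biTranslate, smul_sub, Finset.sum_sub_distrib]
  rw [hsub]
  cases s with
  | zero => simp [biTranslate]
  | succ s => rw [biTranslate_shift_left, biTranslate_shift_right, add_sub_add_right_eq_sub]

/-- Multiplication by `(z - w)^n` commutes with simultaneous translation of `z` and `w`. -/
theorem expand_biTranslate {f : ℤ → ℤ → E} (hf : BddRight f) (s : ℕ) (n m l : ℤ) :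
    expand n (biTranslate s f) m l = biTranslate s (expand n f) m l := by
  have hup : ∀ n, (∀ m l, expand n (biTranslate s f) m l = biTranslate s (expand n f) m l) →
      ∀ m l, expand (n + 1) (biTranslate s f) m l = biTranslate s (expand (n + 1) f) m l := by
    intro n ih m l
    rw [expand_succ (bddRight_biTranslate hf s), ih, ih, biTranslate_sub_comm]
    congr 1
    funext p q
    rw [expand_succ hf]
  induction n using Int.induction_on generalizing m l with
  | zero =>
    rw [expand_zero]
    congr 1
    funext p q
    rw [expand_zero]
  | succ i ih => exact hup _ ih m l
  | pred i ih =>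
    set n : ℤ := -i - 1
    have hn : -(i : ℤ) = n + 1 := by omega
    rw [hn] at ih
    rw [← sub_eq_zero]
    have hb : BddRight fun p q => expand n (biTranslate s f) p q - biTranslate s (expand n f) p q :=
      (bddRight_expand (bddRight_biTranslate hf s) n).sub
        (bddRight_biTranslate (bddRight_expand hf n) s)
    refine hb.eq_zero_of_expand_eq_zero 1 (fun m l => ?_) m l
    rw [show (1 : ℤ) = 0 + 1 by ring, expand_succ hb, expand_zero, expand_zero, sub_sub_sub_comm,
      ← expand_succ (bddRight_biTranslate hf s), ih, biTranslate_sub_comm, sub_eq_zero]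
    congr 1
    funext p q
    rw [expand_succ hf]

end Expansion

/-! ### Fields and their products -/

/-- A field on `V`: a family of operators `A_n`, `n : ℤ`, such that for every `v` one has
`A_n v = 0` for all large `n`. -/
structure VField (k : Type u) [CommRing k] (V : Type v) [AddCommGroup V] [Module k V] where
  /-- the modes `A_n` -/
  op : ℤ → Module.End k V
  trunc : ∀ v : V, ∃ Q : ℤ, ∀ n, Q ≤ n → op n v = 0

namespace VField

variable {k : Type u} [CommRing k] {V : Type v} [AddCommGroup V] [Module k V]

theorem bddRight (A : VField k V) (B : ℤ → V →+ V) (v : V) :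
    BddRight fun p q => B p (A.op q v) := by
  obtain ⟨Q, hQ⟩ := A.trunc v
  exact ⟨Q, fun p q h => by simp only [hQ q h, map_zero]⟩

theorem bddRight' (A B : VField k V) (v : V) : BddRight fun p q => B.op p (A.op q v) :=
  A.bddRight (fun p => (B.op p).toAddMonoidHom) v

/-- The coefficient extracted by `z^m w^l` in
`(z - w)^n A(z) B(w) v - (z - w)^n B(w) A(z) v`, where `(z - w)^n` is expanded in `|z| > |w|` in the
first term and in `|w| > |z|` in the second. -/
noncomputable def borch (A B : VField k V) (m n l : ℤ) (v : V) : V :=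
  expand n (fun p q => A.op p (B.op q v)) m l -
    (n.negOnePow : ℤ) • expand n (fun q p => B.op q (A.op p v)) l m

theorem borch_succ (A B : VField k V) (m n l : ℤ) (v : V) :
    borch A B m (n + 1) l v = borch A B (m + 1) n l v - borch A B m n (l + 1) v := by
  rw [borch, expand_succ (bddRight' B A v), expand_succ (bddRight' A B v), borch, borch,
    Int.negOnePow_succ, Units.val_neg, neg_smul, smul_sub]
  abel

theorem borch_zero (A B : VField k V) (m l : ℤ) (v : V) :
    borch A B m 0 l v = A.op m (B.op l v) - B.op l (A.op m v) := by
  rw [borch, expand_zero, expand_zero]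
  simp

theorem borch_swap (A B : VField k V) (m n l : ℤ) (v : V) :
    borch A B m n l v = -((n.negOnePow : ℤ) • borch B A l n m v) := by
  have : (n.negOnePow : ℤ) * n.negOnePow = 1 := by
    rw [← Units.val_mul, ← Int.negOnePow_add, Int.negOnePow_even _ ⟨n, rfl⟩, Units.val_one]
  rw [borch, borch, smul_sub, smul_smul, this, one_smul, neg_sub]

theorem borch_add (A B : VField k V) (m n l : ℤ) (v v' : V) :
    borch A B m n l (v + v') = borch A B m n l v + borch A B m n l v' := by
  simp only [borch, map_add]
  rw [expand_add (bddRight' B A v) (bddRight' B A v'),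
    expand_add (bddRight' A B v) (bddRight' A B v'), smul_add]
  abel

theorem borch_smul (A B : VField k V) (m n l : ℤ) (r : k) (v : V) :
    borch A B m n l (r • v) = r • borch A B m n l v := by
  simp only [borch, map_smul]
  have h := fun C D : VField k V => expand_map (DistribSMul.toAddMonoidHom V r) (bddRight' C D v)
  simp only [DistribSMul.toAddMonoidHom_apply] at h
  rw [h, h, smul_sub, smul_comm r]

/-- Two fields are local if `(z - w)^N [A(z), B(w)] = 0` for some `N ≥ 0`. -/
def IsLocal (A B : VField k V) : Prop := ∃ N : ℕ, ∀ m l v, borch A B m N l v = 0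

theorem borch_eq_zero_of_le {A B : VField k V} {N : ℕ} (h : ∀ m l v, borch A B m N l v = 0)
    {n : ℤ} (hn : N ≤ n) (m l : ℤ) (v : V) : borch A B m n l v = 0 := by
  obtain ⟨d, rfl⟩ : ∃ d : ℕ, n = N + d := ⟨(n - N).toNat, by omega⟩
  clear hn
  induction d generalizing m l with
  | zero => simpa using h m l v
  | succ d ih => rw [Nat.cast_succ, ← add_assoc, borch_succ, ih, ih, sub_zero]

theorem IsLocal.symm {A B : VField k V} (h : IsLocal A B) : IsLocal B A := by
  obtain ⟨N, hN⟩ := h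
  exact ⟨N, fun m l v => by rw [borch_swap, hN, smul_zero, neg_zero]⟩

/-- The `n`-th product `A_(n) B` of two fields. -/
noncomputable def nprod (A B : VField k V) (n : ℤ) : VField k V where
  op l :=
    { toFun := borch A B 0 n l
      map_add' := borch_add A B 0 n l
      map_smul' := borch_smul A B 0 n l }
  trunc v := by
    obtain ⟨Q, hQ⟩ := B.trunc v
    obtain ⟨P, hP⟩ := A.trunc v
    choose f hf using fun j : ℕ => B.trunc (A.op j v)
    -- only the modes `A_j` with `0 ≤ j < P` contribute to the second expansion
    refine ⟨|Q| + |n| + P.toNat + ∑ j ∈ Finset.range P.toNat, |f j|, fun l hl => ?_⟩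
    have hs : 0 ≤ ∑ j ∈ Finset.range P.toNat, |f j| := Finset.sum_nonneg fun _ _ => abs_nonneg _
    have h1 := le_abs_self Q
    have h2 := neg_abs_le n
    have h3 := abs_nonneg n
    have h4 := abs_nonneg Q
    simp only [LinearMap.coe_mk, AddHom.coe_mk]
    rw [borch, expand_eq_sum (N := 0) fun p j _ => by rw [hQ _ (by omega), map_zero],
      expand_eq_sum (N := P.toNat) fun p j hj => by rw [hP _ (by omega), map_zero],
      Finset.sum_range_zero, Finset.sum_eq_zero, smul_zero, sub_zero]
    intro j hj
    have h5 := Finset.single_le_sum (f := fun j => |f j|) (fun _ _ => abs_nonneg _) hj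
    have h6 := le_abs_self (f j)
    rw [Finset.mem_range] at hj
    rw [zero_add, hf j _ (by omega), smul_zero]

theorem nprod_op (A B : VField k V) (n l : ℤ) (v : V) :
    (nprod A B n).op l v = borch A B 0 n l v := rfl

/-! ### The Borcherds identity for local fields -/

/-- A family that satisfies the recursion of the Borcherds identity vanishes if it vanishes for `m
= 0` and for large `n`. -/
theorem eq_zero_of_recursion {E : Type*} [AddCommGroup E] {H : ℤ → ℤ → ℤ → E} {N : ℤ}
    (hrec : ∀ m n l, H (m + 1) n l = H m (n + 1) l + H m n (l + 1)) (h0 : ∀ n l, H 0 n l = 0)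
    (hN : ∀ m n l, N ≤ n → H m n l = 0) (m n l : ℤ) : H m n l = 0 := by
  induction m using Int.induction_on generalizing n l with
  | zero => exact h0 n l
  | succ i ih => rw [hrec, ih, ih, add_zero]
  | pred i ih =>
    suffices h : ∀ d : ℕ, ∀ n l : ℤ, N ≤ n + d → H (-i - 1) n l = 0 from
      h (N - n).toNat n l (by omega)
    intro d
    induction d with
    | zero => exact fun n l hn => hN _ _ _ (by simpa using hn)
    | succ d ihd =>
      intro n l hn
      have h := hrec (-i - 1) n (l - 1)
      rw [sub_add_cancel, sub_add_cancel, ih, ihd (n + 1) _ (by push_cast at hn; omega),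
        zero_add] at h
      exact h.symm

/-- The Borcherds identity for local fields. Both sides satisfy the same recursion in `m`, agree for
`m = 0` by the definition of the products, and vanish for large `n` by locality. -/
theorem borcherds_of_isLocal {A B : VField k V} (h : IsLocal A B) (m n l : ℤ) (v : V) :
    ∑ᶠ j : ℕ, Ring.choose m j • (nprod A B (n + j)).op (m + l - j) v = borch A B m n l v := by
  obtain ⟨N, hN⟩ := h
  have hsq : ∀ n : ℤ, (n.negOnePow : ℤ) * n.negOnePow = 1 := fun n => by
    rw [← Units.val_mul, ← Int.negOnePow_add, Int.negOnePow_even _ ⟨n, rfl⟩, Units.val_one]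
  -- up to signs the left side is the expansion of `(z - w)^m`, in the variables `l` and `n`
  set f : ℤ → ℤ → V := fun p q => (q.negOnePow : ℤ) • borch A B 0 q p v with hf
  have hb : BddRight f := ⟨N, fun p q hq => by
    simp only [hf, borch_eq_zero_of_le hN hq, smul_zero]⟩
  have hL : ∀ m n l : ℤ, ∑ᶠ j : ℕ, Ring.choose m j • (nprod A B (n + j)).op (m + l - j) v =
      (n.negOnePow : ℤ) • expand m f l n := fun m n l => by
    obtain ⟨M, hM⟩ := hb.exists_nat n
    rw [expand_eq_sum hM, finsum_eq_sum_range (N := M), Finset.smul_sum]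
    · refine Finset.sum_congr rfl fun j _ => ?_
      rw [hf, nprod_op, smul_smul, smul_smul, add_comm m l, Int.negOnePow_add, Units.val_mul,
        Int.coe_negOnePow_natCast]
      congr 1
      linear_combination (-Ring.choose m j) * hsq n - Ring.choose m j *
        (n.negOnePow : ℤ) ^ 2 * (neg_one_pow_mul_self j)
    · intro j hj
      have := hM (m + l - j) j hj
      rw [hf] at this
      have h2 := congrArg (((n + j).negOnePow : ℤ) • ·) this
      simp only [smul_smul, hsq, one_smul, smul_zero] at h2
      rw [nprod_op, h2, smul_zero]
  rw [hL, ← sub_eq_zero]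
  refine eq_zero_of_recursion (N := N)
    (H := fun m n l => (n.negOnePow : ℤ) • expand m f l n - borch A B m n l v) ?_ ?_ ?_ m n l
  · intro m n l
    rw [expand_succ hb, borch_succ A B m n l, Int.negOnePow_succ, Units.val_neg, neg_smul, smul_sub]
    abel
  · intro n l
    simp only [expand_zero, hf, smul_smul, hsq, one_smul, sub_self]
  · intro m n l hn
    rw [borch_eq_zero_of_le hN hn, sub_zero, expand_eq_sum (N := 0) fun p j _ => by
      simp only [hf]
      rw [borch_eq_zero_of_le hN (by omega), smul_zero], Finset.sum_range_zero, smul_zero]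

end VField

/-! ### Dong's lemma -/

section ThreeVariables

variable {E : Type*} [AddCommGroup E]

theorem expand_shift (f : ℤ → ℤ → E) (n m l a b : ℤ) :
    expand n (fun p q => f (p + a) (q + b)) m l = expand n f (m + a) (l + b) := by
  refine finsum_congr fun j => ?_
  simp only
  rw [show m + n - j + a = m + a + n - j by ring, show l + j + b = l + b + j by ring]

theorem pow_add_apply_eq_zero {M : Type*} [AddCommGroup M] {a b : Module.End ℤ M}
    (hab : Commute a b) {x : M} {i j : ℕ} (hi : (a ^ i) x = 0) (hj : (b ^ j) x = 0) :
    ((a + b) ^ (i + j)) x = 0 := by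
  have key : ∀ s t : ℕ, i ≤ s ∨ j ≤ t → (a ^ s * b ^ t) x = 0 := by
    rintro s t (h | h)
    · obtain ⟨d, rfl⟩ := Nat.exists_eq_add_of_le h
      rw [(hab.pow_pow _ _).eq, add_comm, pow_add, Module.End.mul_apply, Module.End.mul_apply, hi,
        map_zero, map_zero]
    · obtain ⟨d, rfl⟩ := Nat.exists_eq_add_of_le h
      rw [add_comm, pow_add, Module.End.mul_apply, Module.End.mul_apply, hj, map_zero, map_zero]
  rw [hab.add_pow, LinearMap.sum_apply]
  refine Finset.sum_eq_zero fun m hm => ?_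
  rw [Finset.mem_range] at hm
  rw [← nsmul_eq_mul', LinearMap.smul_apply, key _ _ (by omega), smul_zero]

variable (E) in
/-- Multiplication by `z₁ - z₂` on distributions in three variables. -/
def diff₁₂ : Module.End ℤ (ℤ → ℤ → ℤ → E) where
  toFun f p q r := f (p + 1) q r - f p (q + 1) r
  map_add' f g := by funext p q r; simp only [Pi.add_apply]; abel
  map_smul' c f := by funext p q r; simp [smul_sub]

variable (E) in
/-- Multiplication by `z₁ - z₃` on distributions in three variables. -/
def diff₁₃ : Module.End ℤ (ℤ → ℤ → ℤ → E) where
  toFun f p q r := f (p + 1) q r - f p q (r + 1)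
  map_add' f g := by funext p q r; simp only [Pi.add_apply]; abel
  map_smul' c f := by funext p q r; simp [smul_sub]

variable (E) in
/-- Multiplication by `z₂ - z₃` on distributions in three variables. -/
def diff₂₃ : Module.End ℤ (ℤ → ℤ → ℤ → E) where
  toFun f p q r := f p (q + 1) r - f p q (r + 1)
  map_add' f g := by funext p q r; simp only [Pi.add_apply]; abel
  map_smul' c f := by funext p q r; simp [smul_sub]

theorem diff₁₂_apply (f : ℤ → ℤ → ℤ → E) (p q r : ℤ) :
    diff₁₂ E f p q r = f (p + 1) q r - f p (q + 1) r := rfl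

theorem diff₁₃_apply (f : ℤ → ℤ → ℤ → E) (p q r : ℤ) :
    diff₁₃ E f p q r = f (p + 1) q r - f p q (r + 1) := rfl

theorem diff₂₃_apply (f : ℤ → ℤ → ℤ → E) (p q r : ℤ) :
    diff₂₃ E f p q r = f p (q + 1) r - f p q (r + 1) := rfl

theorem commute_diff₁₃_diff₁₂ :
    Commute (diff₁₃ E) (diff₁₂ E) := by
  refine LinearMap.ext fun f => ?_
  funext p q r
  simp only [Module.End.mul_apply, diff₁₂_apply, diff₁₃_apply]
  abel

theorem commute_diff₁₃_diff₂₃ :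
    Commute (diff₁₃ E) (diff₂₃ E) := by
  refine LinearMap.ext fun f => ?_
  funext p q r
  simp only [Module.End.mul_apply, diff₂₃_apply, diff₁₃_apply]
  abel

theorem commute_diff₁₂_diff₂₃ :
    Commute (diff₁₂ E) (diff₂₃ E) := by
  refine LinearMap.ext fun f => ?_
  funext p q r
  simp only [Module.End.mul_apply, diff₁₂_apply, diff₂₃_apply]
  abel

theorem diff₂₃_eq : diff₂₃ E = diff₁₃ E + -diff₁₂ E := by
  refine LinearMap.ext fun f => ?_
  funext p q r
  simp only [LinearMap.add_apply, LinearMap.neg_apply, Pi.add_apply, Pi.neg_apply, diff₁₂_apply,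
    diff₁₃_apply, diff₂₃_apply]
  abel

theorem diff₂₃_pow_apply {f : ℤ → ℤ → ℤ → E} {p : ℤ} {g : ℕ → ℤ → ℤ → E}
    (h0 : ∀ q r, g 0 q r = f p q r)
    (hs : ∀ j q r, g (j + 1) q r = g j (q + 1) r - g j q (r + 1)) (j : ℕ) (q r : ℤ) :
    (diff₂₃ E ^ j) f p q r = g j q r := by
  induction j generalizing q r with
  | zero => exact (h0 q r).symm
  | succ j ih => rw [pow_succ', Module.End.mul_apply, diff₂₃_apply, ih, ih, hs]

theorem diff₁₃_pow_apply {f : ℤ → ℤ → ℤ → E} {q : ℤ} {g : ℕ → ℤ → ℤ → E}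
    (h0 : ∀ p r, g 0 p r = f p q r)
    (hs : ∀ j p r, g (j + 1) p r = g j (p + 1) r - g j p (r + 1)) (j : ℕ) (p r : ℤ) :
    (diff₁₃ E ^ j) f p q r = g j p r := by
  induction j generalizing p r with
  | zero => exact (h0 p r).symm
  | succ j ih => rw [pow_succ', Module.End.mul_apply, diff₁₃_apply, ih, ih, hs]

theorem diff₁₃_pow_swap (f : ℤ → ℤ → ℤ → E) (j : ℕ) :
    (diff₁₃ E ^ j) (fun p q r => f q p r) = fun p q r => (diff₂₃ E ^ j) f q p r := by
  induction j with
  | zero => rfl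
  | succ j ih =>
    rw [pow_succ', Module.End.mul_apply, ih, pow_succ']
    rfl

theorem diff₂₃_pow_swap (f : ℤ → ℤ → ℤ → E) (j : ℕ) :
    (diff₂₃ E ^ j) (fun p q r => f q p r) = fun p q r => (diff₁₃ E ^ j) f q p r := by
  induction j with
  | zero => rfl
  | succ j ih =>
    rw [pow_succ', Module.End.mul_apply, ih, pow_succ']
    rfl

/-- Multiplication by `(z₁ - z₂)^n`, expanded in the domain `|z₁| > |z₂|`. -/
noncomputable def expand₁₂ (n : ℤ) (f : ℤ → ℤ → ℤ → E) (p q r : ℤ) : E :=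
  expand n (fun p q => f p q r) p q

theorem expand₁₂_pow_diff₂₃ {f : ℤ → ℤ → ℤ → E} (hf : ∀ r, BddRight fun p q => f p q r) (n : ℤ)
    (j : ℕ) : (∀ r, BddRight fun p q => (diff₂₃ E ^ j) f p q r) ∧
      expand₁₂ n ((diff₂₃ E ^ j) f) = (diff₂₃ E ^ j) (expand₁₂ n f) := by
  induction j with
  | zero => exact ⟨hf, rfl⟩
  | succ j ih =>
    rw [pow_succ', Module.End.mul_apply, Module.End.mul_apply, ← ih.2]
    set g := (diff₂₃ E ^ j) f
    have h1 : ∀ r, BddRight fun p q => g p (q + 1) r := fun r => by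
      simpa using (ih.1 r).shift 0 1
    refine ⟨fun r => (h1 r).sub (ih.1 (r + 1)), ?_⟩
    funext p q r
    have h2 := expand_shift (fun p q => g p q r) n p q 0 1
    simp only [add_zero] at h2
    simp only [expand₁₂, diff₂₃_apply]
    rw [expand_sub (h1 r) (ih.1 (r + 1)), h2]

theorem expand₁₂_pow_diff₁₃ {f : ℤ → ℤ → ℤ → E} (hf : ∀ r, BddRight fun p q => f p q r) (n : ℤ)
    (j : ℕ) : (∀ r, BddRight fun p q => (diff₁₃ E ^ j) f p q r) ∧
      expand₁₂ n ((diff₁₃ E ^ j) f) = (diff₁₃ E ^ j) (expand₁₂ n f) := by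
  induction j with
  | zero => exact ⟨hf, rfl⟩
  | succ j ih =>
    rw [pow_succ', Module.End.mul_apply, Module.End.mul_apply, ← ih.2]
    set g := (diff₁₃ E ^ j) f
    have h1 : ∀ r, BddRight fun p q => g (p + 1) q r := fun r => by
      simpa using (ih.1 r).shift 1 0
    refine ⟨fun r => (h1 r).sub (ih.1 (r + 1)), ?_⟩
    funext p q r
    have h2 := expand_shift (fun p q => g p q r) n p q 1 0
    simp only [add_zero] at h2
    simp only [expand₁₂, diff₁₃_apply]
    rw [expand_sub (h1 r) (ih.1 (r + 1)), h2]

end ThreeVariables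

namespace VField

variable {k : Type u} [CommRing k] {V : Type v} [AddCommGroup V] [Module k V]

/-- The coefficients of `[A(z₁) B(z₂), C(z₃)] v`. -/
def tripleComm (A B C : VField k V) (v : V) (p q r : ℤ) : V :=
  A.op p (B.op q (C.op r v)) - C.op r (A.op p (B.op q v))

theorem bddRight_tripleComm (A B C : VField k V) (v : V) (r : ℤ) :
    BddRight fun p q => tripleComm A B C v p q r :=
  (bddRight' B A (C.op r v)).sub
    (B.bddRight (fun p => (C.op r ∘ₗ A.op p).toAddMonoidHom) v)

/-- `[A(z₁) B(z₂), C(z₃)] v` is annihilated by `(z₁ - z₃)^N₁ (z₂ - z₃)^N₂`. -/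
theorem pow_tripleComm_eq_zero {A B C : VField k V} {N₁ N₂ : ℕ}
    (h₁ : ∀ m l v, borch A C m N₁ l v = 0) (h₂ : ∀ m l v, borch B C m N₂ l v = 0) (v : V) :
    (diff₁₃ V ^ N₁) ((diff₂₃ V ^ N₂) (tripleComm A B C v)) = 0 := by
  have e : tripleComm A B C v = (fun p q r => A.op p (borch B C q 0 r v)) +
      fun p q r => borch A C p 0 r (B.op q v) := by
    funext p q r
    simp only [tripleComm, Pi.add_apply, borch_zero, map_sub]
    abel
  have z₁ : (diff₂₃ V ^ N₂) (fun p q r => A.op p (borch B C q 0 r v)) = 0 := by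
    funext p q r
    rw [diff₂₃_pow_apply (g := fun j q r => A.op p (borch B C q j r v)), h₂, map_zero]
    · rfl
    · intro q r
      rfl
    · intro j q r
      rw [Nat.cast_succ, borch_succ, map_sub]
  have z₂ : (diff₁₃ V ^ N₁) (fun p q r => borch A C p 0 r (B.op q v)) = 0 := by
    funext p q r
    rw [diff₁₃_pow_apply (g := fun j p r => borch A C p j r (B.op q v)), h₁]
    · rfl
    · intro p r
      rfl
    · intro j p r
      rw [Nat.cast_succ, borch_succ]
  rw [e, map_add, z₁, zero_add, ← Module.End.mul_apply,
    (commute_diff₁₃_diff₂₃.pow_pow N₁ N₂).eq, Module.End.mul_apply, z₂, map_zero]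

theorem pow_expand_tripleComm_eq_zero {A B C : VField k V} {N₁ N₂ : ℕ}
    (h₁ : ∀ m l v, borch A C m N₁ l v = 0) (h₂ : ∀ m l v, borch B C m N₂ l v = 0) (n : ℤ) (v : V) :
    (diff₁₃ V ^ N₁) ((diff₂₃ V ^ N₂) (expand₁₂ n (tripleComm A B C v))) = 0 := by
  have hb := bddRight_tripleComm A B C v
  have e := expand₁₂_pow_diff₂₃ hb n N₂
  rw [← e.2, ← (expand₁₂_pow_diff₁₃ e.1 n N₁).2, pow_tripleComm_eq_zero h₁ h₂]
  funext p q r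
  simp [expand₁₂, expand]

/-- The coefficients of `[(z₁ - z₂)^n A(z₁) B(z₂) - (z₁ - z₂)^n B(z₂) A(z₁), C(z₃)] v`. -/
noncomputable def borchComm (A B C : VField k V) (n : ℤ) (v : V) (p q r : ℤ) : V :=
  borch A B p n q (C.op r v) - C.op r (borch A B p n q v)

theorem borchComm_eq (A B C : VField k V) (n : ℤ) (v : V) :
    borchComm A B C n v = expand₁₂ n (tripleComm A B C v) -
      (n.negOnePow : ℤ) • fun p q r => expand₁₂ n (tripleComm B A C v) q p r := by
  funext p q r
  have key : ∀ (A B : VField k V) (p q : ℤ), expand₁₂ n (tripleComm A B C v) p q r =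
      expand n (fun p q => A.op p (B.op q (C.op r v))) p q -
        C.op r (expand n (fun p q => A.op p (B.op q v)) p q) := fun A B p q => by
    rw [expand₁₂, ← AddMonoidHom.coe_coe (C.op r),
      ← expand_map ((C.op r : V →ₗ[k] V) : V →+ V) (bddRight' B A v), ← expand_sub]
    · rfl
    · exact bddRight' B A (C.op r v)
    · exact B.bddRight (fun p => (C.op r ∘ₗ A.op p).toAddMonoidHom) v
  simp only [Pi.sub_apply, Pi.smul_apply, key, borchComm, borch, map_sub, map_zsmul, smul_sub]
  abel

/-- Dong's lemma: products of pairwise local fields are local. -/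
theorem IsLocal.nprod {A B C : VField k V} (hAB : IsLocal A B) (hAC : IsLocal A C)
    (hBC : IsLocal B C) (n : ℤ) : IsLocal (nprod A B n) C := by
  obtain ⟨N, hN⟩ := hAB
  obtain ⟨N₁, h₁⟩ := hAC
  obtain ⟨N₂, h₂⟩ := hBC
  -- multiplication by `(z₁ - z₂)^J` raises the exponent `n` to at least `N`
  set J := (N - n).toNat
  refine ⟨N₁ + J + N₂, fun l r v => ?_⟩
  set Γ := borchComm A B C n v
  have hΓ₁₃ : (diff₁₃ V ^ N₁) ((diff₂₃ V ^ N₂) Γ) = 0 := by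
    have e := pow_expand_tripleComm_eq_zero h₂ h₁ n v
    rw [← Module.End.mul_apply, (commute_diff₁₃_diff₂₃.pow_pow N₂ N₁).eq,
      Module.End.mul_apply] at e
    rw [show Γ = _ from borchComm_eq A B C n v, map_sub, map_sub, map_zsmul, map_zsmul,
      pow_expand_tripleComm_eq_zero h₁ h₂, diff₂₃_pow_swap, diff₁₃_pow_swap, e]
    funext p q r
    simp
  have hΓ₁₂ : (diff₁₂ V ^ J) Γ = 0 := by
    have h : ∀ j : ℕ, (diff₁₂ V ^ j) Γ = borchComm A B C (n + j) v := fun j => by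
      induction j with
      | zero => simp [Γ]
      | succ j ih =>
        rw [pow_succ', Module.End.mul_apply, ih]
        funext p q r
        rw [Nat.cast_succ, ← add_assoc, diff₁₂_apply]
        simp only [borchComm, borch_succ, map_sub]
        abel
    rw [h]
    funext p q r
    simp [borchComm, borch_eq_zero_of_le hN (n := n + J) (by omega)]
  -- `z₂ - z₃ = (z₁ - z₃) - (z₁ - z₂)`, and both summands act nilpotently
  have hΓ : (diff₂₃ V ^ (N₁ + J + N₂)) Γ = 0 := by
    rw [pow_add, Module.End.mul_apply, diff₂₃_eq]
    refine pow_add_apply_eq_zero (commute_diff₁₃_diff₁₂ (E := V)).neg_right ?_ ?_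
    · rw [← diff₂₃_eq]
      exact hΓ₁₃
    · rw [← diff₂₃_eq, neg_pow, Module.End.mul_apply, ← Module.End.mul_apply (diff₁₂ V ^ J),
        (commute_diff₁₂_diff₂₃.pow_pow J N₂).eq, Module.End.mul_apply, hΓ₁₂, map_zero, map_zero]
  have h := diff₂₃_pow_apply (f := Γ) (p := 0)
    (g := fun j q r => borch (VField.nprod A B n) C q j r v)
    (fun q r => by rw [Nat.cast_zero, borch_zero]; rfl)
    (fun j q r => by rw [Nat.cast_succ, borch_succ]) (N₁ + J + N₂) l r
  rw [← h, hΓ]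
  rfl

/-! ### Uniqueness of local fields -/

/-- Goddard's uniqueness argument: two fields that are local with `X` and agree on `z` also agree on
all `X_l z`, since `(z - w)^N` can be cancelled after the fields have been commuted past `X`. -/
theorem op_op_eq_of_isLocal {A B X : VField k V} (hA : IsLocal A X) (hB : IsLocal B X) {z : V}
    (h : ∀ n, A.op n z = B.op n z) (n l : ℤ) : A.op n (X.op l z) = B.op n (X.op l z) := by
  obtain ⟨N₁, h₁⟩ := hA
  obtain ⟨N₂, h₂⟩ := hB
  have hb := (bddRight' X A z).sub (bddRight' X B z)
  rw [← sub_eq_zero]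
  refine hb.eq_zero_of_expand_eq_zero (max N₁ N₂ : ℕ) (fun m l => ?_) n l
  have e₁ := borch_eq_zero_of_le h₁ (n := (max N₁ N₂ : ℕ)) (by simp) m l z
  have e₂ := borch_eq_zero_of_le h₂ (n := (max N₁ N₂ : ℕ)) (by simp) m l z
  rw [expand_sub (bddRight' X A z) (bddRight' X B z)]
  rw [borch, sub_eq_zero] at e₁ e₂
  rw [e₁, e₂]
  simp only [h, sub_self]

/-! ### Sums, multiples, and the identity field -/

/-- The sum of two fields. -/
def add (A B : VField k V) : VField k V where
  op n := A.op n + B.op n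
  trunc v := by
    obtain ⟨Q, hQ⟩ := A.trunc v
    obtain ⟨Q', hQ'⟩ := B.trunc v
    exact ⟨max Q Q', fun n h => by
      rw [LinearMap.add_apply, hQ n (le_trans (le_max_left _ _) h),
        hQ' n (le_trans (le_max_right _ _) h), add_zero]⟩

/-- A multiple of a field. -/
def smul (r : k) (A : VField k V) : VField k V where
  op n := r • A.op n
  trunc v := by
    obtain ⟨Q, hQ⟩ := A.trunc v
    exact ⟨Q, fun n h => by rw [LinearMap.smul_apply, hQ n h, smul_zero]⟩

variable (k V) in
/-- The identity field, whose only mode is `id` in degree `-1`. -/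
def one : VField k V where
  op n := if n = -1 then LinearMap.id else 0
  trunc v := ⟨0, fun n h => by rw [if_neg (by omega)]; rfl⟩

theorem borch_add_left (A B C : VField k V) (m n l : ℤ) (v : V) :
    borch (add A B) C m n l v = borch A C m n l v + borch B C m n l v := by
  simp only [borch, add, LinearMap.add_apply, map_add]
  rw [expand_add (bddRight' C A v) (bddRight' C B v),
    expand_add (bddRight' A C v) (bddRight' B C v), smul_add]
  abel

theorem borch_smul_left (r : k) (A C : VField k V) (m n l : ℤ) (v : V) :
    borch (smul r A) C m n l v = r • borch A C m n l v := by
  have h := fun C D : VField k V => expand_map (DistribSMul.toAddMonoidHom V r) (bddRight' C D v)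
  simp only [DistribSMul.toAddMonoidHom_apply] at h
  simp only [borch, smul, LinearMap.smul_apply, map_smul]
  rw [h, h, smul_sub, smul_comm r]

theorem IsLocal.add {A B C : VField k V} (hA : IsLocal A C) (hB : IsLocal B C) :
    IsLocal (add A B) C := by
  obtain ⟨N₁, h₁⟩ := hA
  obtain ⟨N₂, h₂⟩ := hB
  exact ⟨max N₁ N₂, fun m l v => by
    rw [borch_add_left, borch_eq_zero_of_le h₁ (by simp), borch_eq_zero_of_le h₂ (by simp),
      add_zero]⟩

theorem IsLocal.smul {A C : VField k V} (hA : IsLocal A C) (r : k) : IsLocal (smul r A) C := by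
  obtain ⟨N, h⟩ := hA
  exact ⟨N, fun m l v => by rw [borch_smul_left, h, smul_zero]⟩

theorem isLocal_one (C : VField k V) : IsLocal (one k V) C :=
  ⟨0, fun m l v => by
    rw [Nat.cast_zero, borch_zero, one]
    by_cases h : m = -1 <;> simp [h]⟩

/-! ### Translation covariance -/

/-- A field `A` is covariant for the divided powers `T r` of a translation operator if
`T^(r) A_n = ∑_{a+b=r} (-1)^a (n choose a) A_{n-a} T^(b)`. -/
def IsCovariant (T : ℕ → V →ₗ[k] V) (A : VField k V) : Prop :=
  ∀ (r : ℕ) (n : ℤ) (v : V), T r (A.op n v) =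
    ∑ a ∈ antidiagonal r, ((-1 : ℤ) ^ a.1 * Ring.choose n a.1) • A.op (n - a.1) (T a.2 v)

variable {T : ℕ → V →ₗ[k] V}

theorem IsCovariant.op_op {A B : VField k V} (hA : IsCovariant T A) (hB : IsCovariant T B)
    (r : ℕ) (p q : ℤ) (v : V) : T r (A.op p (B.op q v)) = ∑ a ∈ antidiagonal r,
      (-1 : ℤ) ^ a.1 • biTranslate a.1 (fun p q => A.op p (B.op q (T a.2 v))) p q := by
  have h := sum_antidiagonal_assoc (fun i j l =>
    ((-1 : ℤ) ^ i * Ring.choose p i * ((-1 : ℤ) ^ j * Ring.choose q j)) •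
      A.op (p - i) (B.op (q - j) (T l v))) r
  rw [hA]
  simp only [hB _ _ _, map_sum, map_zsmul, Finset.smul_sum, smul_smul]
  rw [← h]
  refine Finset.sum_congr rfl fun a _ => ?_
  rw [biTranslate, Finset.smul_sum]
  refine Finset.sum_congr rfl fun b hb => ?_
  rw [smul_smul, ← mem_antidiagonal.1 hb, pow_add]
  congr 1
  ring

theorem IsCovariant.expand {A B : VField k V} (hA : IsCovariant T A) (hB : IsCovariant T B)
    (r : ℕ) (n m l : ℤ) (v : V) : T r (expand n (fun p q => A.op p (B.op q v)) m l) =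
      ∑ a ∈ antidiagonal r, (-1 : ℤ) ^ a.1 •
        biTranslate a.1 (_root_.expand n fun p q => A.op p (B.op q (T a.2 v))) m l := by
  rw [← AddMonoidHom.coe_coe (T r), ← expand_map (T r : V →+ V) (bddRight' B A v)]
  simp only [AddMonoidHom.coe_coe, hA.op_op hB]
  have hb : ∀ a : ℕ × ℕ,
      BddRight (biTranslate a.1 fun p q => A.op p (B.op q (T a.2 v))) := fun a =>
    bddRight_biTranslate (bddRight' B A (T a.2 v)) a.1
  rw [expand_sum fun a _ => (hb a).zsmul fun _ _ => (-1 : ℤ) ^ a.1]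
  refine Finset.sum_congr rfl fun a _ => ?_
  rw [← expand_biTranslate (bddRight' B A (T a.2 v))]
  exact expand_map (DistribSMul.toAddMonoidHom V ((-1 : ℤ) ^ a.1)) (hb a) n m l

theorem biTranslate_zero_left {E : Type*} [AddCommGroup E] (s : ℕ) (f : ℤ → ℤ → E) (q : ℤ) :
    biTranslate s f 0 q = Ring.choose q s • f 0 (q - s) := by
  rw [biTranslate, Finset.sum_eq_single (0, s)]
  · simp
  · intro a ha hne
    rw [mem_antidiagonal] at ha
    rw [Ring.choose_zero_pos ℤ, zero_mul, zero_smul]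
    by_contra h0
    exact hne (Prod.ext (by simpa using h0) (by simp; omega))
  · simp [mem_antidiagonal]

theorem biTranslate_zero_right {E : Type*} [AddCommGroup E] (s : ℕ) (f : ℤ → ℤ → E) (p : ℤ) :
    biTranslate s f p 0 = Ring.choose p s • f (p - s) 0 := by
  rw [biTranslate, Finset.sum_eq_single (s, 0)]
  · simp
  · intro a ha hne
    rw [mem_antidiagonal] at ha
    rw [Ring.choose_zero_pos ℤ, mul_zero, zero_smul]
    by_contra h0
    exact hne (Prod.ext (by simp; omega) (by simpa using h0))
  · simp [mem_antidiagonal]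

theorem IsCovariant.nprod {A B : VField k V} (hA : IsCovariant T A) (hB : IsCovariant T B)
    (n : ℤ) : IsCovariant T (nprod A B n) := by
  intro r l v
  rw [nprod_op, borch, map_sub, map_zsmul, hA.expand hB, hB.expand hA, Finset.smul_sum,
    ← Finset.sum_sub_distrib]
  refine Finset.sum_congr rfl fun a _ => ?_
  rw [biTranslate_zero_left, biTranslate_zero_right, nprod_op, borch, smul_sub, smul_smul,
    smul_smul, smul_smul, smul_smul]
  congr 2
  ring

theorem IsCovariant.add {A B : VField k V} (hA : IsCovariant T A) (hB : IsCovariant T B) :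
    IsCovariant T (add A B) := by
  intro r n v
  simp only [VField.add, LinearMap.add_apply, map_add, hA r n v, hB r n v, smul_add,
    Finset.sum_add_distrib]

theorem IsCovariant.smul {A : VField k V} (hA : IsCovariant T A) (c : k) :
    IsCovariant T (smul c A) := by
  intro r n v
  simp only [VField.smul, LinearMap.smul_apply, map_smul, hA r n v, Finset.smul_sum, smul_comm c]

theorem isCovariant_one : IsCovariant T (one k V) := by
  intro r n v
  rw [Finset.sum_eq_single (0, r)]
  · by_cases h : n = -1 <;> simp [one, h]
  · intro a ha hne
    rw [mem_antidiagonal] at ha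
    have h0 : a.1 ≠ 0 := fun h0 => hne (Prod.ext h0 (by simp; omega))
    by_cases h : n - a.1 = -1
    · have hn : n = ((a.1 - 1 : ℕ) : ℤ) := by omega
      rw [hn, Ring.choose_natCast, Nat.choose_eq_zero_of_lt (by omega)]
      simp
    · simp [one, h]
  · simp [mem_antidiagonal]

end VField

/-! ### The state-field correspondence -/

namespace VField

variable {k : Type u} [CommRing k] {V : Type v} [AddCommGroup V] [Module k V]

theorem borch_eq_finsum (A B : VField k V) (m n l : ℤ) (v : V) :
    borch A B m n l v = ∑ᶠ j : ℕ, ((-1 : ℤ) ^ j * Ring.choose n j) •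
      (A.op (m + n - j) (B.op (l + j) v) -
        (n.negOnePow : ℤ) • B.op (n + l - j) (A.op (m + j) v)) := by
  obtain ⟨N, hN⟩ := (bddRight' B A v).exists_nat l
  obtain ⟨N', hN'⟩ := (bddRight' A B v).exists_nat m
  rw [borch, expand_eq_sum fun p j hj => hN p j (le_trans (le_max_left N N') hj),
    expand_eq_sum fun p j hj => hN' p j (le_trans (le_max_right N N') hj),
    finsum_eq_sum_range (N := max N N') fun j hj => by
      rw [hN _ j (le_trans (le_max_left N N') hj), hN' _ j (le_trans (le_max_right N N') hj),
        smul_zero, sub_zero, smul_zero], Finset.smul_sum, ← Finset.sum_sub_distrib]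
  refine Finset.sum_congr rfl fun j _ => ?_
  rw [smul_sub, smul_comm, add_comm l n]

theorem nprod_op_of_nonneg {A B : VField k V} {v : V} (hA : ∀ n, 0 ≤ n → A.op n v = 0)
    (hB : ∀ n, 0 ≤ n → B.op n v = 0) (n : ℤ) {l : ℤ} (hl : 0 ≤ l) :
    (nprod A B n).op l v = 0 := by
  rw [nprod_op, borch_eq_finsum]
  refine finsum_eq_zero_of_forall_eq_zero fun j => ?_
  rw [hA _ (by positivity), hB _ (by positivity)]
  simp

theorem nprod_op_neg_one {A B : VField k V} {v : V} (hA : ∀ n, 0 ≤ n → A.op n v = 0)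
    (hB : ∀ n, 0 ≤ n → B.op n v = 0) (n : ℤ) :
    (nprod A B n).op (-1) v = A.op n (B.op (-1) v) := by
  rw [nprod_op, borch_eq_finsum, finsum_eq_single _ 0]
  · rw [hA _ (by positivity)]
    simp
  · intro j hj
    rw [hA _ (by positivity), hB _ (by omega)]
    simp

/-- A family of fields that generates `V` from the vacuum vector: the input of the reconstruction
theorem for vertex algebras. `T r` plays the role of `∂^(r)`. -/
structure IsGenerating {ι : Type*} (vac : V) (T : ℕ → V →ₗ[k] V) (X : ι → VField k V) : Prop where
  isLocal : ∀ i j, IsLocal (X i) (X j)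
  op_vac : ∀ i n, 0 ≤ n → (X i).op n vac = 0
  T_vac : ∀ r, T r vac = if r = 0 then vac else 0
  covariant : ∀ i, IsCovariant T (X i)
  eq_top : ∀ M : Submodule k V, vac ∈ M → (∀ i, ∀ v ∈ M, (X i).op (-1) v ∈ M) → M = ⊤

/-- The fields which occur in the vertex algebra generated by the fields `X i`. -/
structure IsStateField {ι : Type*} (vac : V) (T : ℕ → V →ₗ[k] V) (X : ι → VField k V)
    (A : VField k V) : Prop where
  isLocal : ∀ i, IsLocal A (X i)
  op_vac : ∀ n, 0 ≤ n → A.op n vac = 0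
  covariant : IsCovariant T A

variable {ι : Type*} {vac : V} {T : ℕ → V →ₗ[k] V} {X : ι → VField k V}

theorem IsStateField.op_neg_one_sub {A : VField k V} (hA : IsStateField vac T X A)
    (hT : ∀ r, T r vac = if r = 0 then vac else 0) (j : ℕ) :
    A.op (-1 - j) vac = T j (A.op (-1) vac) := by
  rw [hA.covariant, Finset.sum_eq_single (j, 0)]
  · have h := VertexStructure.choose_neg_one_sub 0 j
    rw [Nat.cast_zero, sub_zero] at h
    rw [hT, if_pos rfl, h, ← mul_assoc, neg_one_pow_mul_self]
    simp
  · intro a ha hne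
    rw [mem_antidiagonal] at ha
    rw [hT, if_neg fun h => hne (Prod.ext (by simp; omega) h), map_zero, smul_zero]
  · simp [mem_antidiagonal]

namespace IsGenerating

theorem isStateField (h : IsGenerating vac T X) (i : ι) : IsStateField vac T X (X i) :=
  ⟨h.isLocal i, h.op_vac i, h.covariant i⟩

/-- A field of the generated vertex algebra is determined by the state `A_{-1} 1`. -/
theorem op_eq (h : IsGenerating vac T X) {A B : VField k V} (hA : IsStateField vac T X A)
    (hB : IsStateField vac T X B) (hAB : A.op (-1) vac = B.op (-1) vac) (n : ℤ) (v : V) :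
    A.op n v = B.op n v := by
  let M : Submodule k V := ⨅ n, LinearMap.eqLocus (A.op n) (B.op n)
  have hM : ∀ v, v ∈ M ↔ ∀ n, A.op n v = B.op n v := fun v => by
    simp only [M, Submodule.mem_iInf, LinearMap.mem_eqLocus]
  have htop : M = ⊤ := by
    refine h.eq_top M ((hM _).2 fun n => ?_) fun i v hv => (hM _).2 fun n => ?_
    · rcases le_or_gt 0 n with hn | hn
      · rw [hA.op_vac n hn, hB.op_vac n hn]
      · obtain ⟨j, rfl⟩ : ∃ j : ℕ, n = -1 - j := ⟨(-1 - n).toNat, by omega⟩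
        rw [hA.op_neg_one_sub h.T_vac, hB.op_neg_one_sub h.T_vac, hAB]
    · exact op_op_eq_of_isLocal (hA.isLocal i) (hB.isLocal i) ((hM v).1 hv) n _
  exact (hM v).1 (htop ▸ Submodule.mem_top) n

/-- Every state is the state of a field of the generated vertex algebra: the states which have a
field form a submodule that is stable under the `X_{-1}`, by Dong's lemma. -/
theorem exists_isStateField (h : IsGenerating vac T X) (a : V) :
    ∃ A, IsStateField vac T X A ∧ A.op (-1) vac = a ∧
      ∀ C, (∀ i, IsLocal C (X i)) → IsLocal A C := by
  let M : Submodule k V :=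
    { carrier := {a | ∃ A, IsStateField vac T X A ∧ A.op (-1) vac = a ∧
        ∀ C, (∀ i, IsLocal C (X i)) → IsLocal A C}
      zero_mem' := ⟨smul 0 (one k V),
        ⟨fun i => (isLocal_one _).smul 0, fun n _ => by simp [smul], isCovariant_one.smul 0⟩,
        by simp [smul], fun C _ => (isLocal_one C).smul 0⟩
      add_mem' := by
        rintro _ _ ⟨A, hA, rfl, hA'⟩ ⟨B, hB, rfl, hB'⟩
        exact ⟨add A B, ⟨fun i => (hA.isLocal i).add (hB.isLocal i),
          fun n hn => by simp [add, hA.op_vac n hn, hB.op_vac n hn],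
          hA.covariant.add hB.covariant⟩, rfl, fun C hC => (hA' C hC).add (hB' C hC)⟩
      smul_mem' := by
        rintro r _ ⟨A, hA, rfl, hA'⟩
        exact ⟨smul r A, ⟨fun i => (hA.isLocal i).smul r,
          fun n hn => by simp [smul, hA.op_vac n hn],
          hA.covariant.smul r⟩, rfl, fun C hC => (hA' C hC).smul r⟩ }
  have htop : M = ⊤ := by
    refine h.eq_top M ?_ ?_
    · exact ⟨one k V, ⟨fun i => isLocal_one _, fun n hn => by
        simp [one, show n ≠ -1 by omega], isCovariant_one⟩, by simp [one],
        fun C _ => isLocal_one C⟩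
    · rintro i _ ⟨A, hA, rfl, hA'⟩
      have hloc := (hA.isLocal i).symm
      refine ⟨nprod (X i) A (-1), ⟨fun j => hloc.nprod (h.isLocal i j) (hA.isLocal j) _,
        fun n hn => nprod_op_of_nonneg (h.op_vac i) hA.op_vac _ hn,
        (h.covariant i).nprod hA.covariant _⟩, nprod_op_neg_one (h.op_vac i) hA.op_vac _,
        fun C hC => hloc.nprod (hC i).symm (hA' C hC) _⟩
  exact (htop ▸ Submodule.mem_top : a ∈ M)

/-- The field that corresponds to the state `a`. -/
noncomputable def field (h : IsGenerating vac T X) (a : V) : VField k V :=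
  (h.exists_isStateField a).choose

theorem isStateField_field (h : IsGenerating vac T X) (a : V) :
    IsStateField vac T X (h.field a) := (h.exists_isStateField a).choose_spec.1

theorem field_op_neg_one (h : IsGenerating vac T X) (a : V) : (h.field a).op (-1) vac = a :=
  (h.exists_isStateField a).choose_spec.2.1

theorem isLocal_field (h : IsGenerating vac T X) (a b : V) : IsLocal (h.field a) (h.field b) :=
  (h.exists_isStateField a).choose_spec.2.2 _ (h.isStateField_field b).isLocal

theorem field_op_eq (h : IsGenerating vac T X) {A : VField k V} (hA : IsStateField vac T X A)
    (n : ℤ) (v : V) : (h.field (A.op (-1) vac)).op n v = A.op n v :=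
  h.op_eq (h.isStateField_field _) hA (h.field_op_neg_one _) n v

theorem field_add (h : IsGenerating vac T X) (a b : V) (n : ℤ) (v : V) :
    (h.field (a + b)).op n v = (h.field a).op n v + (h.field b).op n v := by
  have hA := h.isStateField_field a
  have hB := h.isStateField_field b
  have e := h.field_op_eq (A := add (h.field a) (h.field b))
    ⟨fun i => (hA.isLocal i).add (hB.isLocal i),
      fun n hn => by simp [add, hA.op_vac n hn, hB.op_vac n hn],
      hA.covariant.add hB.covariant⟩ n v
  simpa only [add, LinearMap.add_apply, field_op_neg_one] using e

theorem field_smul (h : IsGenerating vac T X) (r : k) (a : V) (n : ℤ) (v : V) :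
    (h.field (r • a)).op n v = r • (h.field a).op n v := by
  have hA := h.isStateField_field a
  have e := h.field_op_eq (A := smul r (h.field a))
    ⟨fun i => (hA.isLocal i).smul r, fun n hn => by simp [smul, hA.op_vac n hn],
      hA.covariant.smul r⟩ n v
  simpa only [smul, LinearMap.smul_apply, field_op_neg_one] using e

theorem field_vac (h : IsGenerating vac T X) (n : ℤ) (v : V) :
    (h.field vac).op n v = if n = -1 then v else 0 := by
  have e := h.field_op_eq (A := one k V) ⟨fun i => isLocal_one _, fun n hn => by
    simp [one, show n ≠ -1 by omega], isCovariant_one⟩ n v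
  simp only [one, if_true, LinearMap.id_apply] at e
  rw [e]
  split_ifs <;> rfl

/-- The field of the state `A_n B_{-1} 1` is the `n`-th product of the fields `A` and `B`. -/
theorem field_nprod (h : IsGenerating vac T X) {A B : VField k V} (hA : IsStateField vac T X A)
    (hB : IsStateField vac T X B) (hAB : IsLocal A B) (n l : ℤ) (v : V) :
    (h.field (A.op n (B.op (-1) vac))).op l v = (nprod A B n).op l v := by
  rw [← nprod_op_neg_one hA.op_vac hB.op_vac]
  exact h.field_op_eq ⟨fun i => hAB.nprod (hA.isLocal i) (hB.isLocal i) n,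
    fun l hl => nprod_op_of_nonneg hA.op_vac hB.op_vac n hl, hA.covariant.nprod hB.covariant n⟩ l v

/-- The products `a_(n) v` of the generated vertex algebra. -/
noncomputable def product (h : IsGenerating vac T X) (n : ℤ) : V →ₗ[k] V →ₗ[k] V :=
  LinearMap.mk₂ k (fun a v => (h.field a).op n v) (fun a b v => h.field_add a b n v)
    (fun r a v => h.field_smul r a n v) (fun _ => map_add _) (fun r _ => map_smul _ r)

theorem product_apply (h : IsGenerating vac T X) (n : ℤ) (a v : V) :
    h.product n a v = (h.field a).op n v := rfl

theorem product_borcherds (h : IsGenerating vac T X) (m n l : ℤ) (a b c : V) :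
    ∑ᶠ j : ℕ, Ring.choose m j • h.product (m + l - j) (h.product (n + j) a b) c =
      ∑ᶠ j : ℕ, ((-1 : ℤ) ^ j * Ring.choose n j) •
        (h.product (m + n - j) a (h.product (l + j) b c) -
          (n.negOnePow : ℤ) • h.product (n + l - j) b (h.product (m + j) a c)) := by
  simp only [product_apply]
  rw [← borch_eq_finsum, ← borcherds_of_isLocal (h.isLocal_field a b)]
  refine finsum_congr fun j => ?_
  have e := h.field_nprod (h.isStateField_field a) (h.isStateField_field b) (h.isLocal_field a b)
    (n + j) (m + l - j) c
  rw [field_op_neg_one] at e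
  rw [e]

end IsGenerating

end VField

namespace ConformalStructure

variable {k : Type u} [CommRing k] {C : Type v} [AddCommGroup C] [Module k C]
  {S : ConformalStructure k C}

/-! ### The generating fields on `UC` -/

/-- The modes of elements of `C` form fields. -/
theorem exists_mode_eq_zero (z : S.Envelope) :
    ∀ x : C, ∃ Q : ℤ, ∀ n, Q ≤ n → S.mode n x z = 0 := by
  induction z using envelope_induction with
  | one => exact fun x => ⟨0, fun n hn => mode_one_of_nonneg hn x⟩
  | add a b ha hb =>
    intro x
    obtain ⟨Q, hQ⟩ := ha x
    obtain ⟨Q', hQ'⟩ := hb x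
    exact ⟨max Q Q', fun n h => by
      rw [map_add, hQ n (le_trans (le_max_left _ _) h), hQ' n (le_trans (le_max_right _ _) h),
        add_zero]⟩
  | smul r a ha =>
    intro x
    obtain ⟨Q, hQ⟩ := ha x
    exact ⟨Q, fun n h => by rw [map_smul, hQ n h, smul_zero]⟩
  | mul y z hz =>
    intro x
    obtain ⟨Q, hQ⟩ := hz x
    obtain ⟨N, hN⟩ := S.exists_mul_eq_zero x y
    choose f hf using fun j : ℕ => hz (S.mul j x y)
    -- `[x_n, y_{-1}]` involves the modes `(x_(j) y)_{n-1-j}` with `j < N` only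
    refine ⟨|Q| + N + 1 + ∑ j ∈ Finset.range N, |f j|, fun n hn => ?_⟩
    have h1 := le_abs_self Q
    have h2 := abs_nonneg Q
    have hs : 0 ≤ ∑ j ∈ Finset.range N, |f j| := Finset.sum_nonneg fun _ _ => abs_nonneg _
    rw [mode_incl_mul, hQ n (by omega), mul_zero, zero_add, S.bracket_eq_sum _ _ _ hN,
      LinearMap.sum_apply]
    refine Finset.sum_eq_zero fun j hj => ?_
    have h3 := Finset.single_le_sum (f := fun j => |f j|) (fun _ _ => abs_nonneg _) hj
    have h4 := le_abs_self (f j)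
    rw [Finset.mem_range] at hj
    rw [LinearMap.smul_apply, hf j _ (by omega), smul_zero]

/-- The field on `UC` that is attached to an element of `C`. -/
noncomputable def modeField (S : ConformalStructure k C) (x : C) : VField k S.Envelope where
  op n := S.mode n x
  trunc z := exists_mode_eq_zero z x

theorem modeField_op (x : C) (n : ℤ) : (S.modeField x).op n = S.mode n x := rfl

/-- The commutator formula for the modes of `C`, multiplied by `(z - w)^n`; the sum is empty for
large `n`, which is the locality of the fields. -/
theorem borch_modeField (x y : C) (n : ℕ) (m l : ℤ) (z : S.Envelope) {N : ℕ}
    (hN : ∀ j, N ≤ j → S.mul j x y = 0) :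
    VField.borch (S.modeField x) (S.modeField y) m n l z =
      ∑ j ∈ Finset.range N, Ring.choose m j • S.mode (m + l - j) (S.mul (n + j) x y) z := by
  induction n generalizing m l N with
  | zero =>
    rw [Nat.cast_zero, VField.borch_zero, modeField_op, modeField_op,
      mode_comm, add_sub_cancel_left, S.bracket_eq_sum _ _ _ hN, LinearMap.sum_apply]
    simp
  | succ n ih =>
    rw [Nat.cast_succ, VField.borch_succ, ih (N := N + 1) _ _ fun j hj => hN j (by omega),
      ih (N := N + 1) _ _ fun j hj => hN j (by omega), ← Finset.sum_sub_distrib,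
      Finset.sum_range_succ']
    simp only [Nat.cast_zero, Ring.choose_zero_right, add_zero, sub_zero]
    rw [show m + 1 + l = m + (l + 1) by ring, sub_self, add_zero]
    refine Finset.sum_congr rfl fun j _ => ?_
    rw [Ring.choose_succ_succ, ← sub_smul, add_sub_cancel_right,
      show m + (l + 1) - ((j + 1 : ℕ) : ℤ) = m + l - j by push_cast; ring,
      show n + (j + 1) = n + 1 + j by ring]

theorem isGenerating_modeField (S : ConformalStructure k C) :
    VField.IsGenerating 1 S.trans S.modeField where
  isLocal x y := by
    obtain ⟨N, hN⟩ := S.exists_mul_eq_zero x y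
    refine ⟨N, fun m l z => ?_⟩
    rw [borch_modeField x y N m l z hN]
    exact Finset.sum_eq_zero fun j _ => by
      rw [hN _ (by omega), map_zero, LinearMap.zero_apply, smul_zero]
  op_vac x n hn := mode_one_of_nonneg hn x
  T_vac := S.trans_one
  covariant x r n z := by
    rw [modeField_op, trans_mode]
    refine Finset.sum_congr rfl fun p _ => ?_
    rw [isMode_mode, LinearMap.smul_apply, modeField_op]
  eq_top M h1 hM := by
    rw [eq_top_iff]
    rintro z -
    induction z using envelope_induction with
    | one => exact h1
    | add a b ha hb => exact M.add_mem ha hb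
    | smul r a ha => exact M.smul_mem r ha
    | mul x z hz =>
      rw [← mode_neg_one]
      exact hM x z hz

/-- The product `a_(n) b` on `UC`. -/
noncomputable def envelopeMul (S : ConformalStructure k C) (n : ℤ) :
    S.Envelope →ₗ[k] S.Envelope →ₗ[k] S.Envelope :=
  S.isGenerating_modeField.product n

theorem mode_neg_one_one (x : C) : S.mode (-1) x 1 = S.incl x := by
  rw [mode_neg_one, mul_one]

theorem envelopeMul_incl (n : ℤ) (x : C) (z : S.Envelope) :
    S.envelopeMul n (S.incl x) z = S.mode n x z := by
  have h := S.isGenerating_modeField.field_op_eq (S.isGenerating_modeField.isStateField x) n z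
  rwa [modeField_op, mode_neg_one_one] at h

theorem envelopeMul_one_left (n : ℤ) (z : S.Envelope) :
    S.envelopeMul n 1 z = if n = -1 then z else 0 :=
  S.isGenerating_modeField.field_vac n z

theorem envelopeMul_one (a : S.Envelope) : S.envelopeMul (-1) a 1 = a :=
  S.isGenerating_modeField.field_op_neg_one a

theorem envelopeMul_one_of_nonneg (n : ℤ) (a : S.Envelope) (hn : 0 ≤ n) :
    S.envelopeMul n a 1 = 0 :=
  (S.isGenerating_modeField.isStateField_field a).op_vac n hn

/-- The field of the product `x a`, with `x` in `C`, is the normally ordered product of the fields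
of `x` and `a`. -/
theorem envelopeMul_incl_mul (n : ℤ) (x : C) (a b : S.Envelope) :
    S.envelopeMul n (S.incl x * a) b = ∑ᶠ j : ℕ, ((-1 : ℤ) ^ j * Ring.choose (-1 : ℤ) j) •
      (S.mode (-1 - j) x (S.envelopeMul (n + j) a b) -
        ((-1 : ℤ).negOnePow : ℤ) • S.envelopeMul (-1 + n - j) a (S.mode j x b)) := by
  have hg := S.isGenerating_modeField
  have h := hg.field_nprod (hg.isStateField x) (hg.isStateField_field a)
    ((hg.isStateField_field a).isLocal x).symm (-1) n b
  rw [hg.field_op_neg_one, modeField_op, mode_neg_one, VField.nprod_op, VField.borch_eq_finsum] at h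
  simp only [zero_add] at h
  exact h

/-! ### The grading of `UC` -/

theorem mem_degreePart {M : Type*} [AddCommGroup M] [Module k M] {gr : ℕ → Submodule k M} {d : ℤ}
    {x : M} : x ∈ degreePart gr d ↔ x = 0 ∨ ∃ e : ℕ, d = e ∧ x ∈ gr e := by
  cases d with
  | ofNat e =>
    constructor
    · exact fun h => Or.inr ⟨e, rfl, h⟩
    · rintro (rfl | ⟨e', he, h⟩)
      · exact Submodule.zero_mem _
      · obtain rfl : e = e' := Int.ofNat.inj he
        exact h
  | negSucc e =>
    constructor
    · exact fun h => Or.inl h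
    · rintro (rfl | ⟨e', he, h⟩)
      · exact Submodule.zero_mem _
      · omega

theorem one_mem_envelopeGr : (1 : S.Envelope) ∈ S.envelopeGr 0 :=
  ⟨1, Submodule.subset_span ⟨[], by simp⟩, map_one S.proj⟩

theorem incl_mul_mem_envelopeGr {i n : ℕ} {x : C} {z : S.Envelope} (hx : x ∈ S.gr i)
    (hz : z ∈ S.envelopeGr n) : S.incl x * z ∈ S.envelopeGr (i + n) := by
  obtain ⟨t, ht, rfl⟩ := hz
  refine ⟨TensorAlgebra.ι k x * t, ?_, map_mul S.proj _ _⟩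
  have h : S.tensorGr n ≤
      (S.tensorGr (i + n)).comap (LinearMap.mulLeft k (TensorAlgebra.ι k x)) := by
    refine Submodule.span_le.2 ?_
    rintro _ ⟨l, hl, hn, rfl⟩
    refine Submodule.subset_span ⟨(i, x) :: l, ?_, by simp [hn], by simp⟩
    rintro q hq
    rcases List.mem_cons.1 hq with rfl | hq
    · exact hx
    · exact hl q hq
  exact h ht

theorem incl_mem_envelopeGr {i : ℕ} {x : C} (hx : x ∈ S.gr i) : S.incl x ∈ S.envelopeGr i := by
  simpa using incl_mul_mem_envelopeGr hx one_mem_envelopeGr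

theorem envelopeGr_induction {P : ℕ → S.Envelope → Prop} (one : P 0 1) (zero : ∀ n, P n 0)
    (add : ∀ n a b, P n a → P n b → P n (a + b)) (smul : ∀ n (r : k) a, P n a → P n (r • a))
    (mul : ∀ i n x z, x ∈ S.gr i → z ∈ S.envelopeGr n → P n z → P (i + n) (S.incl x * z))
    {n : ℕ} {z : S.Envelope} (hz : z ∈ S.envelopeGr n) : P n z := by
  have h : ∀ l : List (ℕ × C), (∀ q ∈ l, q.2 ∈ S.gr q.1) →
      (l.map fun q => S.incl q.2).prod ∈ S.envelopeGr (l.map fun q => q.1).sum ∧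
        P (l.map fun q => q.1).sum (l.map fun q => S.incl q.2).prod := by
    intro l
    induction l with
    | nil => exact fun _ => ⟨by simpa using one_mem_envelopeGr, by simpa using one⟩
    | cons q l ih =>
      intro hl
      obtain ⟨h1, h2⟩ := ih fun q hq => hl q (List.mem_cons_of_mem _ hq)
      have hq := hl q List.mem_cons_self
      simp only [List.map_cons, List.prod_cons, List.sum_cons]
      exact ⟨incl_mul_mem_envelopeGr hq h1, mul _ _ _ _ hq h1 h2⟩
  obtain ⟨t, ht, rfl⟩ := hz
  induction ht using Submodule.span_induction with
  | mem t ht =>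
    obtain ⟨l, hl, rfl, rfl⟩ := ht
    have := (h l hl).2
    rw [AlgHom.toLinearMap_apply, map_list_prod, List.map_map]
    exact this
  | zero => simpa using zero n
  | add a b _ _ ha hb => simpa using add n _ _ ha hb
  | smul r a _ ha => simpa using smul n r _ ha

theorem iSup_envelopeGr (S : ConformalStructure k C) : ⨆ n, S.envelopeGr n = ⊤ := by
  rw [eq_top_iff]
  rintro z -
  induction z using envelope_induction with
  | one => exact Submodule.mem_iSup_of_mem 0 one_mem_envelopeGr
  | add a b ha hb => exact Submodule.add_mem _ ha hb
  | smul r a ha => exact Submodule.smul_mem _ r ha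
  | mul x z hz =>
    have hx : x ∈ ⨆ i, S.gr i := by
      rw [S.internal.submodule_iSup_eq_top]
      trivial
    induction hx using Submodule.iSup_induction' with
    | zero => simp
    | add x y _ _ hx hy =>
      rw [map_add, add_mul]
      exact Submodule.add_mem _ hx hy
    | mem i x hx =>
      induction hz using Submodule.iSup_induction' with
      | zero => simp
      | add y z _ _ hy hz =>
        rw [mul_add]
        exact Submodule.add_mem _ hy hz
      | mem n z hz => exact Submodule.mem_iSup_of_mem _ (incl_mul_mem_envelopeGr hx hz)

theorem mul_mem_degreePart (S : ConformalStructure k C) {n i j : ℕ} {x y : C} (hx : x ∈ S.gr i)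
    (hy : y ∈ S.gr j) : S.mul n x y = 0 ∨ ∃ e : ℕ, (i : ℤ) + j - n - 1 = e ∧ S.mul n x y ∈ S.gr e :=
  mem_degreePart.1 (S.mul_mem n i j x y hx hy)

/-- The bracket on `C` has degree zero, so that the relations of `UC` are homogeneous. -/
theorem lie_mem {i j : ℕ} {x y : C} (hx : x ∈ S.gr i) (hy : y ∈ S.gr j) :
    S.lie x y ∈ S.gr (i + j) := by
  obtain ⟨N, hN⟩ := S.exists_mul_eq_zero x y
  rw [lie, finsum_eq_sum_range (N := N) fun j hj => by rw [hN j hj, map_zero, smul_zero]]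
  refine Submodule.sum_mem _ fun n _ => ?_
  rcases S.mul_mem_degreePart (n := n) hx hy with h | ⟨e, he, h⟩
  · rw [h, map_zero, smul_zero]
    exact Submodule.zero_mem _
  · have := S.D_mem (n + 1) e _ h
    rw [show e + (n + 1) = i + j by omega] at this
    exact Submodule.smul_of_tower_mem _ _ this

/-- The map `C → UC[t]` that sends a homogeneous element `x` of degree `i` to `x t^i`. -/
noncomputable def degreeMap (S : ConformalStructure k C) : C →ₗ[k] Polynomial S.Envelope :=
  (DirectSum.toModule k ℕ (Polynomial S.Envelope) fun i =>
      ((Polynomial.monomial i : S.Envelope →ₗ[S.Envelope] _).restrictScalars k ∘ₗ S.incl) ∘ₗ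
        (S.gr i).subtype) ∘ₗ
    (LinearEquiv.ofBijective (DirectSum.coeLinearMap S.gr) S.internal).symm.toLinearMap

theorem degreeMap_apply {i : ℕ} {x : C} (hx : x ∈ S.gr i) :
    S.degreeMap x = Polynomial.monomial i (S.incl x) := by
  have h : (LinearEquiv.ofBijective (DirectSum.coeLinearMap S.gr) S.internal).symm x =
      DirectSum.lof k ℕ (fun i => S.gr i) i ⟨x, hx⟩ := by
    rw [LinearEquiv.symm_apply_eq]
    exact (DirectSum.coeLinearMap_lof S.gr i ⟨x, hx⟩).symm
  rw [degreeMap, LinearMap.comp_apply, LinearEquiv.coe_coe, h, DirectSum.toModule_lof]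
  rfl

theorem degreeMap_mul_sub (x y : C) :
    S.degreeMap x * S.degreeMap y - S.degreeMap y * S.degreeMap x = S.degreeMap (S.lie x y) := by
  have hl : ∀ x y, S.lie x y = S.bracket S.vacMode (-1) (-1) x y := lie_eq_bracket
  have htop : ∀ x : C, x ∈ ⨆ i, S.gr i := fun x => by
    rw [S.internal.submodule_iSup_eq_top]
    trivial
  induction htop x using Submodule.iSup_induction' with
  | zero => simp [hl]
  | add x x' _ _ hx hx' =>
    rw [hl] at hx hx' ⊢
    rw [map_add, map_add, LinearMap.add_apply, map_add, ← hx, ← hx', add_mul, mul_add]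
    abel
  | mem i x hx =>
    induction htop y using Submodule.iSup_induction' with
    | zero => simp [hl]
    | add y y' _ _ hy hy' =>
      rw [hl] at hy hy' ⊢
      rw [map_add, map_add, map_add, ← hy, ← hy', add_mul, mul_add]
      abel
    | mem j y hy =>
      rw [degreeMap_apply hx, degreeMap_apply hy, degreeMap_apply (lie_mem hx hy),
        Polynomial.monomial_mul_monomial, Polynomial.monomial_mul_monomial, add_comm j i,
        ← map_sub, incl_mul_sub]

/-- The homomorphism `UC → UC[t]` that sends a homogeneous element `z` of degree `n` to `z t^n`. -/
noncomputable def degreeHom (S : ConformalStructure k C) :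
    S.Envelope →ₐ[k] Polynomial S.Envelope :=
  envelopeLift S.degreeMap degreeMap_mul_sub

theorem degreeHom_apply {n : ℕ} {z : S.Envelope} (hz : z ∈ S.envelopeGr n) :
    S.degreeHom z = Polynomial.monomial n z := by
  refine envelopeGr_induction (P := fun n z => S.degreeHom z = Polynomial.monomial n z)
    ?_ ?_ ?_ ?_ ?_ hz
  · simp
  · simp
  · intro n a b ha hb
    rw [map_add, map_add, ha, hb]
  · intro n r a ha
    rw [map_smul, ha, Polynomial.smul_monomial]
  · intro i n x z hx _ hz
    rw [map_mul, hz, degreeHom, envelopeLift_incl, degreeMap_apply hx,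
      Polynomial.monomial_mul_monomial]

/-- The sum of the components of `UC` is direct, since `degreeHom` separates them. -/
theorem isInternal_envelopeGr (S : ConformalStructure k C) :
    DirectSum.IsInternal S.envelopeGr := by
  have hcoe : ∀ (d : DirectSum ℕ fun n => S.envelopeGr n) (n : ℕ),
      (S.degreeHom (DirectSum.coeLinearMap S.envelopeGr d)).coeff n = d n := by
    intro d n
    induction d using DirectSum.induction_on with
    | zero => simp
    | of i z =>
      rw [← DirectSum.lof_eq_of k, DirectSum.coeLinearMap_lof, degreeHom_apply z.2,
        Polynomial.coeff_monomial, DirectSum.lof_eq_of]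
      split_ifs with h
      · subst h
        rw [DirectSum.of_eq_same]
      · rw [DirectSum.of_eq_of_ne _ _ _ (Ne.symm h), Submodule.coe_zero]
    | add a b ha hb =>
      rw [map_add, map_add, Polynomial.coeff_add, ha, hb, DirectSum.add_apply, Submodule.coe_add]
  constructor
  · intro d d' h
    refine DFinsupp.ext fun n => Subtype.ext ?_
    have h' : DirectSum.coeLinearMap S.envelopeGr d = DirectSum.coeLinearMap S.envelopeGr d' := h
    rw [← hcoe, ← hcoe, h']
  · have h := DirectSum.range_coeLinearMap (A := S.envelopeGr)
    rw [iSup_envelopeGr, LinearMap.range_eq_top] at h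
    exact h

/-- The modes of a homogeneous element of `C` are homogeneous. -/
theorem mode_mem {i : ℕ} {x : C} (hx : x ∈ S.gr i) (n d : ℤ) {z : S.Envelope}
    (hz : z ∈ degreePart S.envelopeGr d) :
    S.mode n x z ∈ degreePart S.envelopeGr (i + d - n - 1) := by
  rcases mem_degreePart.1 hz with rfl | ⟨e, rfl, he⟩
  · rw [map_zero]
    exact Submodule.zero_mem _
  clear hz
  refine envelopeGr_induction (P := fun e z => ∀ (i : ℕ) (n : ℤ) (x : C), x ∈ S.gr i →
    S.mode n x z ∈ degreePart S.envelopeGr (i + e - n - 1)) ?_ ?_ ?_ ?_ ?_ he i n x hx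
  · intro i n x hx
    rw [mem_degreePart]
    rcases le_or_gt 0 n with hn | hn
    · exact Or.inl (mode_one_of_nonneg hn x)
    · obtain ⟨j, rfl⟩ : ∃ j : ℕ, n = -1 - j := ⟨(-1 - n).toNat, by omega⟩
      refine Or.inr ⟨i + j, by push_cast; ring, ?_⟩
      rw [mode_one, vacMode_neg_one_sub]
      exact incl_mem_envelopeGr (S.D_mem j i x hx)
  · intro e i n x _
    rw [map_zero]
    exact Submodule.zero_mem _
  · intro e a b ha hb i n x hx
    rw [map_add]
    exact Submodule.add_mem _ (ha i n x hx) (hb i n x hx)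
  · intro e r a ha i n x hx
    rw [map_smul]
    exact Submodule.smul_mem _ r (ha i n x hx)
  · intro j e y z hy hz ih i n x hx
    rw [mode_incl_mul]
    refine Submodule.add_mem _ ?_ ?_
    · rcases mem_degreePart.1 (ih i n x hx) with h | ⟨e', he', h⟩
      · rw [h, mul_zero]
        exact Submodule.zero_mem _
      · exact mem_degreePart.2 (Or.inr ⟨j + e', by push_cast; omega, incl_mul_mem_envelopeGr hy h⟩)
    · obtain ⟨N, hN⟩ := S.exists_mul_eq_zero x y
      rw [S.bracket_eq_sum _ _ _ hN, LinearMap.sum_apply]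
      refine Submodule.sum_mem _ fun t _ => ?_
      rw [LinearMap.smul_apply]
      refine Submodule.smul_of_tower_mem _ _ ?_
      rcases S.mul_mem_degreePart (n := t) hx hy with h | ⟨e', he', h⟩
      · rw [h, map_zero, LinearMap.zero_apply]
        exact Submodule.zero_mem _
      · have := ih e' (n + -1 - t) _ h
        rwa [← he', show (i : ℤ) + j - t - 1 + e - (n + -1 - t) - 1 = i + (j + e : ℕ) - n - 1 by
          push_cast; ring] at this

theorem finsum_mem_submodule {M : Type*} [AddCommGroup M] [Module k M] (P : Submodule k M)
    {f : ℕ → M} (hf : ∀ j, f j ∈ P) : ∑ᶠ j, f j ∈ P :=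
  finsum_induction (· ∈ P) P.zero_mem (fun _ _ => P.add_mem) hf

theorem envelopeMul_mem {i : ℕ} {a : S.Envelope} (ha : a ∈ S.envelopeGr i) (n d : ℤ)
    {b : S.Envelope} (hb : b ∈ degreePart S.envelopeGr d) :
    S.envelopeMul n a b ∈ degreePart S.envelopeGr (i + d - n - 1) := by
  refine envelopeGr_induction (P := fun i a => ∀ (n d : ℤ) (b : S.Envelope),
    b ∈ degreePart S.envelopeGr d → S.envelopeMul n a b ∈ degreePart S.envelopeGr (i + d - n - 1))
    ?_ ?_ ?_ ?_ ?_ ha n d b hb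
  · intro n d b hb
    rw [envelopeMul_one_left]
    split_ifs with h
    · subst h
      simpa using hb
    · exact Submodule.zero_mem _
  · intro i n d b _
    rw [map_zero, LinearMap.zero_apply]
    exact Submodule.zero_mem _
  · intro i a a' ha ha' n d b hb
    rw [map_add, LinearMap.add_apply]
    exact Submodule.add_mem _ (ha n d b hb) (ha' n d b hb)
  · intro i r a ha n d b hb
    rw [map_smul, LinearMap.smul_apply]
    exact Submodule.smul_mem _ r (ha n d b hb)
  · intro i j x a hx _ ih n d b hb
    rw [envelopeMul_incl_mul]
    refine finsum_mem_submodule _ fun t => Submodule.smul_of_tower_mem _ _ ?_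
    refine Submodule.sub_mem _ ?_ (Submodule.smul_of_tower_mem _ _ ?_)
    · have h := mode_mem hx (-1 - t) _ (ih (n + t) d b hb)
      rwa [show (i : ℤ) + (j + d - (n + t) - 1) - (-1 - t) - 1 = (i + j : ℕ) + d - n - 1 by
        push_cast; ring] at h
    · have h := ih (-1 + n - t) _ _ (mode_mem hx t d hb)
      rwa [show (j : ℤ) + (i + d - t - 1) - (-1 + n - t) - 1 = (i + j : ℕ) + d - n - 1 by
        push_cast; ring] at h

/-- The vertex algebra structure on `UC`. -/
noncomputable def envelopeVertex (S : ConformalStructure k C) : VertexStructure k S.Envelope where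
  gr := S.envelopeGr
  internal := S.isInternal_envelopeGr
  vac := 1
  vac_mem := one_mem_envelopeGr
  mul := S.envelopeMul
  mul_mem n _ j _ _ ha hb := envelopeMul_mem ha n j (mem_degreePart.2 (Or.inr ⟨j, rfl, hb⟩))
  vac_mul := envelopeMul_one_left
  mul_vac := envelopeMul_one
  mul_vac_of_nonneg := envelopeMul_one_of_nonneg
  borcherds := S.isGenerating_modeField.product_borcherds

theorem isEnvelopeStructure_envelopeVertex (S : ConformalStructure k C) :
    S.IsEnvelopeStructure S.envelopeVertex where
  vac_eq := (map_one S.proj).symm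
  incl_isHom :=
    { map_gr := fun _ _ ha => incl_mem_envelopeGr ha
      map_D := fun j a => by
        have h : S.envelopeMul (-1 - j) (S.incl a) 1 = S.incl (S.D j a) := by
          rw [envelopeMul_incl, mode_one, vacMode_neg_one_sub]
        exact h.symm
      map_mul := fun n a b => by
        have h : S.envelopeMul n (S.incl a) (S.incl b) = S.incl (S.mul n a b) := by
          have h1 := mode_incl_mul n a b (1 : S.Envelope)
          rw [mul_one, mode_one_of_nonneg (by positivity), mul_zero, zero_add] at h1
          obtain ⟨N, hN⟩ := S.exists_mul_eq_zero a b
          rw [envelopeMul_incl, h1, S.bracket_eq_sum _ _ _ (N := max N (n + 1)) fun j hj =>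
            hN j (le_trans (le_max_left _ _) hj), LinearMap.sum_apply,
            Finset.sum_eq_single n]
          · rw [LinearMap.smul_apply, show (n : ℤ) + -1 - n = -1 by ring, mode_neg_one_one,
              Ring.choose_natCast, Nat.choose_self, Nat.cast_one, one_smul]
          · intro j _ hj
            rw [LinearMap.smul_apply, Ring.choose_natCast]
            rcases lt_or_gt_of_ne hj with hj | hj
            · rw [mode_one_of_nonneg (by omega), smul_zero]
            · rw [Nat.choose_eq_zero_of_lt hj, Nat.cast_zero, zero_smul]
          · simp
        exact h.symm }
  proj_ι_mul x z := by
    have h : S.envelopeMul (-1) (S.incl x) (S.proj z) = S.incl x * S.proj z := by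
      rw [envelopeMul_incl, mode_neg_one]
    rw [map_mul]
    exact h.symm

end ConformalStructure

/-! ### The universal property of `UC` -/

theorem map_finsum_of_forall_le {E E' : Type*} [AddCommMonoid E] [AddCommMonoid E'] (g : E →+ E')
    {f : ℕ → E} {N : ℕ} (h : ∀ j, N ≤ j → f j = 0) : g (∑ᶠ j, f j) = ∑ᶠ j, g (f j) := by
  rw [finsum_eq_sum_range h, finsum_eq_sum_range (N := N) fun j hj => by rw [h j hj, map_zero],
    map_sum]

/-- A direct sum decomposition that refines another one componentwise is equal to it. -/
theorem DirectSum.IsInternal.eq_of_le {k M : Type*} [CommRing k] [AddCommGroup M] [Module k M]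
    {A B : ℕ → Submodule k M} (hA : DirectSum.IsInternal A) (hB : DirectSum.IsInternal B)
    (h : ∀ n, A n ≤ B n) : A = B := by
  funext n
  refine le_antisymm (h n) fun x hx => ?_
  have hx' : x ∈ A n ⊔ ⨆ i, ⨆ _ : i ≠ n, A i := by
    have htop : ⨆ i, A i ≤ A n ⊔ ⨆ i, ⨆ _ : i ≠ n, A i := by
      refine iSup_le fun i => ?_
      by_cases hi : i = n
      · subst hi
        exact le_sup_left
      · exact le_sup_of_le_right (le_iSup₂_of_le i hi le_rfl)
    rw [hA.submodule_iSup_eq_top] at htop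
    exact htop trivial
  obtain ⟨a, ha, b, hb, rfl⟩ := Submodule.mem_sup.1 hx'
  have hb' : b ∈ ⨆ i, ⨆ _ : i ≠ n, B i := iSup₂_mono (fun i _ => h i) hb
  have hbn : b ∈ B n := by
    have := (B n).sub_mem hx (h n ha)
    rwa [add_sub_cancel_left] at this
  have h0 := Submodule.disjoint_def.1 (hB.submodule_iSupIndep n) b hbn hb'
  rw [h0, add_zero]
  exact ha

namespace VertexStructure

variable {k : Type u} [CommRing k] {V : Type v} [AddCommGroup V] [Module k V]
  (S : VertexStructure k V)

/-- `(∂^(i) a)_(n) = (-1)^i (n choose i) a_(n-i)` for all integers `n`. -/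
theorem mul_D_int (i : ℕ) (n : ℤ) (a b : V) :
    S.mul n (S.D i a) b = ((-1 : ℤ) ^ i * Ring.choose n i) • S.mul (n - i) a b := by
  rcases le_or_gt 0 n with hn | hn
  · lift n to ℕ using hn
    rw [S.mul_D, Ring.choose_natCast]
    rcases le_or_gt i n with hi | hi
    · rw [Nat.cast_sub hi]
    · rw [Nat.choose_eq_zero_of_lt hi]
      simp
  · obtain ⟨t, rfl⟩ : ∃ t : ℕ, n = -1 - t := ⟨(-1 - n).toNat, by omega⟩
    rw [D_apply, borcherds_zero, finsum_eq_single _ t]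
    · rw [S.vac_mul, if_pos (by ring), S.vac_mul, if_neg (by omega), smul_zero, sub_zero,
        choose_neg_one_sub, choose_neg_one_sub, ← mul_assoc, ← mul_assoc, neg_one_pow_mul_self,
        neg_one_pow_mul_self, add_comm t i, Nat.choose_symm_add,
        show (-1 - (i : ℤ) - t) = -1 - t - i by ring]
    · intro j hj
      rw [S.vac_mul, if_neg (by omega), S.vac_mul, if_neg (by omega)]
      simp

/-- The commutator formula `[a_(m), b_(l)] = ∑_j (m choose j) (a_(j) b)_(m+l-j)`. -/
theorem mul_mul_int (m l : ℤ) (a b c : V) : S.mul m a (S.mul l b c) = S.mul l b (S.mul m a c) +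
    ∑ᶠ j : ℕ, Ring.choose m j • S.mul (m + l - j) (S.mul j a b) c := by
  have h := S.borcherds m 0 l a b c
  rw [finsum_eq_single (fun j : ℕ => ((-1 : ℤ) ^ j * Ring.choose (0 : ℤ) j) • _) 0
    (fun j hj => by rw [Ring.choose_zero_pos ℤ (by omega), mul_zero, zero_smul])] at h
  simp only [zero_add] at h
  rw [h]
  simp

end VertexStructure

namespace ConformalStructure

variable {k : Type u} [CommRing k] {C : Type v} [AddCommGroup C] [Module k C]
  {S : ConformalStructure k C} {V : Type w} [AddCommGroup V] [Module k V]
  {S' : VertexStructure k V} {f : C →ₗ[k] V}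

/-- The modes `f(x)_(n)` of the elements of `C` on a vertex algebra `V`, for a map `f : C → V`. -/
def homMode (S' : VertexStructure k V) (f : C →ₗ[k] V) (n : ℤ) : C →ₗ[k] Module.End k V :=
  S'.mul n ∘ₗ f

theorem homMode_apply (n : ℤ) (x : C) (v : V) : homMode S' f n x v = S'.mul n (f x) v := rfl

theorem isMode_homMode (hf : IsConformalHom S S'.toConformal f) : S.IsMode (homMode S' f) := by
  intro n i a
  ext v
  have h : f (S.D i a) = S'.D i (f a) := hf.map_D i a
  rw [LinearMap.smul_apply, homMode_apply, h, S'.mul_D_int]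
  rfl

theorem homMode_comm (hf : IsConformalHom S S'.toConformal f) (m l : ℤ) (x y : C) (v : V) :
    homMode S' f m x (homMode S' f l y v) =
      homMode S' f l y (homMode S' f m x v) + S.bracket (homMode S' f) m l x y v := by
  have h := S.bracket_comp (LinearMap.applyₗ (R := k) v) (homMode S' f) m l x y
  rw [LinearMap.applyₗ_apply_apply] at h
  rw [← h, bracket_def, homMode_apply, homMode_apply, homMode_apply, homMode_apply,
    S'.mul_mul_int m l]
  congr 1
  refine finsum_congr fun j => ?_
  have h : f (S.mul j x y) = S'.mul j (f x) (f y) := hf.map_mul j x y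
  rw [← h]
  rfl

/-- The extension of a morphism `f : C → V` of conformal algebras to `UC`. -/
noncomputable def extend (hf : IsConformalHom S S'.toConformal f) : S.Envelope →ₗ[k] V :=
  LinearMap.applyₗ S'.vac ∘ₗ (envelopeLift (homMode S' f (-1)) fun x y => by
    rw [← bracket_neg_one_neg_one (isMode_homMode hf)]
    ext v
    rw [LinearMap.sub_apply, Module.End.mul_apply, Module.End.mul_apply, homMode_comm hf,
      add_sub_cancel_left]).toLinearMap

theorem extend_one (hf : IsConformalHom S S'.toConformal f) : extend hf 1 = S'.vac := by
  simp [extend]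

theorem extend_incl_mul (hf : IsConformalHom S S'.toConformal f) (x : C) (z : S.Envelope) :
    extend hf (S.incl x * z) = S'.mul (-1) (f x) (extend hf z) := by
  simp [extend, envelopeLift_incl, homMode_apply]

theorem extend_incl (hf : IsConformalHom S S'.toConformal f) (x : C) :
    extend hf (S.incl x) = f x := by
  rw [← mul_one (S.incl x), extend_incl_mul, extend_one, S'.mul_vac]

theorem extend_mode (hf : IsConformalHom S S'.toConformal f) (n : ℤ) (x : C) (z : S.Envelope) :
    extend hf (S.mode n x z) = homMode S' f n x (extend hf z) := by
  induction z using envelope_induction generalizing n x with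
  | one =>
    rcases le_or_gt 0 n with hn | hn
    · rw [mode_one_of_nonneg hn, map_zero, extend_one, homMode_apply, S'.mul_vac_of_nonneg n _ hn]
    · obtain ⟨j, rfl⟩ : ∃ j : ℕ, n = -1 - j := ⟨(-1 - n).toNat, by omega⟩
      rw [mode_one, vacMode_neg_one_sub, extend_incl, extend_one]
      exact hf.map_D j x
  | add a b ha hb => simp only [map_add, ha, hb]
  | smul r a ha => simp only [map_smul, ha]
  | mul y z hz =>
    obtain ⟨N, hN⟩ := S.exists_mul_eq_zero x y
    rw [mode_incl_mul, map_add, extend_incl_mul, extend_incl_mul, ← homMode_apply (f := f),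
      ← homMode_apply (f := f), homMode_comm hf, hz, S.bracket_eq_sum _ _ _ hN,
      S.bracket_eq_sum _ _ _ hN]
    simp only [LinearMap.sum_apply, LinearMap.smul_apply, map_sum, map_zsmul, hz]

/-- `extend` respects all products: if `F` respects the products with `a` then, by the expression of
`(x_(-1) a)_(n)` through the products with `x` and with `a`, it also respects those with `x a`. -/
theorem extend_envelopeMul (hf : IsConformalHom S S'.toConformal f) (n : ℤ) (a b : S.Envelope) :
    extend hf (S.envelopeMul n a b) = S'.mul n (extend hf a) (extend hf b) := by
  induction a using envelope_induction generalizing n b with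
  | one =>
    rw [envelopeMul_one_left, extend_one, S'.vac_mul]
    split_ifs
    · rfl
    · exact map_zero _
  | add a a' ha ha' => simp only [map_add, LinearMap.add_apply, ha, ha']
  | smul r a ha => simp only [map_smul, LinearMap.smul_apply, ha]
  | mul x a ha =>
    obtain ⟨N, hN⟩ := (S.envelopeVertex.toConformal).exists_mul_eq_zero a b
    have hN' : ∀ q : ℤ, N ≤ q → S.envelopeMul q a b = 0 := fun q hq => by
      lift q to ℕ using by omega
      exact hN q (by omega)
    obtain ⟨Q, hQ⟩ := exists_mode_eq_zero b x
    rw [envelopeMul_incl_mul, extend_incl_mul, S'.borcherds_zero]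
    -- beyond this bound both `a_(n+j) b` and `x_j b` vanish
    refine (map_finsum_of_forall_le (extend hf).toAddMonoidHom
      (N := (N - n).toNat + Q.toNat) fun j hj => ?_).trans (finsum_congr fun j => ?_)
    · rw [hN' _ (by omega), hQ _ (by omega), map_zero, map_zero, smul_zero, sub_zero, smul_zero]
    · simp only [LinearMap.toAddMonoidHom_coe, map_zsmul, map_sub, extend_mode, ha, homMode_apply]

theorem extend_mem (hf : IsConformalHom S S'.toConformal f) {n : ℕ} {z : S.Envelope}
    (hz : z ∈ S.envelopeGr n) : extend hf z ∈ S'.gr n := by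
  refine envelopeGr_induction (P := fun n z => extend hf z ∈ S'.gr n) ?_ ?_ ?_ ?_ ?_ hz
  · rw [extend_one]
    exact S'.vac_mem
  · intro n
    rw [map_zero]
    exact Submodule.zero_mem _
  · intro n a b ha hb
    rw [map_add]
    exact Submodule.add_mem _ ha hb
  · intro n r a ha
    rw [map_smul]
    exact Submodule.smul_mem _ r ha
  · intro i n x z hx _ hz
    rw [extend_incl_mul]
    have h := S'.mul_mem (-1) i n _ _ (hf.map_gr i x hx) hz
    rwa [show (i : ℤ) + n - -1 - 1 = Int.ofNat (i + n) by
      simp only [Int.ofNat_eq_natCast]; push_cast; ring] at h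

theorem isVertexHom_extend (hf : IsConformalHom S S'.toConformal f) :
    IsVertexHom S.envelopeVertex S' (extend hf) :=
  ⟨fun _ _ ha => extend_mem hf ha, extend_one hf, extend_envelopeMul hf⟩

/-- A morphism of vertex algebras on `UC` is determined by its restriction to `C`. -/
theorem eq_extend (hf : IsConformalHom S S'.toConformal f) {g : S.Envelope →ₗ[k] V}
    (hg : IsVertexHom S.envelopeVertex S' g) (hgf : ∀ x, g (S.incl x) = f x) :
    g = extend hf := by
  ext z
  induction z using envelope_induction with
  | one => exact hg.map_vac.trans (extend_one hf).symm
  | add a b ha hb => rw [map_add, map_add, ha, hb]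
  | smul r a ha => rw [map_smul, map_smul, ha]
  | mul x z hz =>
    have h : g (S.envelopeMul (-1) (S.incl x) z) = S'.mul (-1) (g (S.incl x)) (g z) :=
      hg.map_mul (-1) _ _
    rw [envelopeMul_incl, mode_neg_one] at h
    rw [h, extend_incl_mul, hz, hgf]

/-- The vertex algebra structure on `UC` is unique: for any other structure `W`, the extension of
`i` to a morphism from `UC` to `UC` with the structure `W` is the identity. -/
theorem IsEnvelopeStructure.eq_envelopeVertex {W : VertexStructure k S.Envelope}
    (hW : S.IsEnvelopeStructure W) : W = S.envelopeVertex := by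
  have hvac : W.vac = 1 := hW.vac_eq.trans (map_one S.proj)
  have hid : ∀ z, extend hW.incl_isHom z = z := fun z => by
    induction z using envelope_induction with
    | one => rw [extend_one, hvac]
    | add a b ha hb => rw [map_add, ha, hb]
    | smul r a ha => rw [map_smul, ha]
    | mul x z hz =>
      obtain ⟨t, rfl⟩ := proj_surjective z
      rw [extend_incl_mul, hz, ← hW.proj_ι_mul, map_mul]
      rfl
  refine VertexStructure.ext ?_ hvac ?_
  · refine (S.isInternal_envelopeGr.eq_of_le W.internal fun n z hz => ?_).symm
    have h := extend_mem hW.incl_isHom hz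
    rwa [hid] at h
  · funext n
    ext a b
    have h := extend_envelopeMul hW.incl_isHom n a b
    rw [hid, hid, hid] at h
    exact h.symm

end ConformalStructure

/-! ### The adjunction -/

namespace ConformalAlg

variable {k : Type u} [CommRing k]

/-- The enveloping vertex algebra of a conformal algebra. -/
noncomputable def envelope (C : ConformalAlg.{u, max u v} k) : VertexAlg.{u, max u v} k :=
  { carrier := C.str.Envelope, str := C.str.envelopeVertex }

/-- The canonical map `i : C → UC` as a morphism of conformal algebras. -/
noncomputable def toEnvelope (C : ConformalAlg.{u, max u v} k) :
    C ⟶ (VertexAlg.forgetToConformal.{u, max u v} k).obj C.envelope :=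
  ⟨C.str.incl, C.str.isEnvelopeStructure_envelopeVertex.incl_isHom⟩

/-- Morphisms `UC → V` of vertex algebras correspond to morphisms `C → V` of conformal algebras. -/
noncomputable def envelopeHomEquiv (C : ConformalAlg.{u, max u v} k)
    (V : VertexAlg.{u, max u v} k) :
    (C.envelope ⟶ V) ≃ (C ⟶ (VertexAlg.forgetToConformal.{u, max u v} k).obj V) where
  toFun g := C.toEnvelope ≫ (VertexAlg.forgetToConformal.{u, max u v} k).map g
  invFun f := ⟨ConformalStructure.extend f.isHom, ConformalStructure.isVertexHom_extend f.isHom⟩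
  left_inv g := VertexAlg.Hom.ext
    (ConformalStructure.eq_extend (S := C.str) (S' := V.str) (f := g.lin ∘ₗ C.str.incl)
      (C.toEnvelope ≫ (VertexAlg.forgetToConformal.{u, max u v} k).map g).isHom g.isHom
      fun _ => rfl).symm
  right_inv f := ConformalAlg.Hom.ext (LinearMap.ext fun x =>
    ConformalStructure.extend_incl (S := C.str) (S' := V.str) f.isHom x)

theorem envelopeHomEquiv_comp (C : ConformalAlg.{u, max u v} k) (V V' : VertexAlg.{u, max u v} k)
    (g : V ⟶ V') (h : C.envelope ⟶ V) :
    C.envelopeHomEquiv V' (h ≫ g) =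
      C.envelopeHomEquiv V h ≫ (VertexAlg.forgetToConformal.{u, max u v} k).map g := by
  rfl

end ConformalAlg

theorem theorem8p3 (k : Type u) [CommRing k] :
    (∀ (C : Type w) [AddCommGroup C] [Module k C] (S : ConformalStructure k C),
      ∃ W : VertexStructure k S.Envelope,
        S.IsEnvelopeStructure W ∧ W.gr = S.envelopeGr ∧
        ∀ W' : VertexStructure k S.Envelope, S.IsEnvelopeStructure W' → W' = W) ∧
    (∃ W : ∀ C : ConformalAlg.{u, max u v} k, VertexStructure k C.str.Envelope,
      (∀ C : ConformalAlg.{u, max u v} k, C.str.IsEnvelopeStructure (W C)) ∧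
      ∃ (U : ConformalAlg.{u, max u v} k ⥤ VertexAlg.{u, max u v} k)
        (hU : ∀ C : ConformalAlg.{u, max u v} k, U.obj C = { carrier := C.str.Envelope, str := W C })
        (adj : U ⊣ VertexAlg.forgetToConformal.{u, max u v} k),
        ∀ (C : ConformalAlg.{u, max u v} k) (x : C.carrier),
          (adj.unit.app C ≫
            (VertexAlg.forgetToConformal.{u, max u v} k).map (eqToHom (hU C))).lin x =
              C.str.incl x) := by
  refine ⟨fun C _ _ S => ⟨S.envelopeVertex, S.isEnvelopeStructure_envelopeVertex, rfl,
    fun W' hW' => hW'.eq_envelopeVertex⟩, fun C => C.str.envelopeVertex,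
    fun C => C.str.isEnvelopeStructure_envelopeVertex,
    Adjunction.leftAdjointOfEquiv ConformalAlg.envelopeHomEquiv ConformalAlg.envelopeHomEquiv_comp,
    fun C => rfl,
    Adjunction.adjunctionOfEquivLeft ConformalAlg.envelopeHomEquiv
      ConformalAlg.envelopeHomEquiv_comp, fun C x => ?_⟩
  have h := (Adjunction.adjunctionOfEquivLeft ConformalAlg.envelopeHomEquiv
    ConformalAlg.envelopeHomEquiv_comp).homEquiv_id C
  rw [Adjunction.adjunctionOfEquivLeft, Adjunction.mkOfHomEquiv_homEquiv] at h
  exact (congrArg (fun g => ConformalAlg.Hom.lin g x) h).symm
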